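/- Let $\mathbb{F}$ be an algebraically closed field and let $Q$ be a finite quiver, with set of vertices $Q_0$, set of arrows $Q_1$ and set $Q_i$ of paths of length $i$; write $pq$ for the path "first $p$, then $q$". Let $I\subseteq \mathbb{F}Q_{\ge 2}$ be a two-sided ideal of the path algebra $\mathbb{F}Q$, contained in the span of the paths of length at least $2$ and homogeneous for path length, and let $\Lambda=\mathbb{F}Q/I=\bigoplus_{i\ge 0}\Lambda_i$ with the induced grading. Let $\mathcal{B}$ be a set of paths in $Q$ whose images form an $\mathbb{F}$-basis of $\Lambda$, and let $<$ be a total order on $Q_1$, extended to paths by comparing lengths first and then, for paths of equal length, lexicographically from the first arrow. The pair $(\mathcal{B},<)$ is called a *PBW basis* of $\Lambda$ if 1. for all $p,q\in\mathcal{B}$, either $pq\in\mathcal{B}$, or the element $pq\in\Lambda$ is a linear combination of elements $r\in\mathcal{B}$ with $r<pq$ (if $p,q$ are not composable, $pq=0$ and this holds trivially); and 2. for each $i\ge 3$ and each path $\alpha_1\alpha_2\cdots\alpha_i\in Q_i$, one has $\alpha_1\cdots\alpha_i\in\mathcal{B}$ if and only if $\alpha_1\cdots\alpha_j\in\mathcal{B}$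 and $\alpha_{j+1}\cdots\alpha_i\in\mathcal{B}$ for every $1\le j\le i-1$. **Theorem.** If $\Lambda$ has a PBW basis, then $\Lambda$ is Koszul. That is, $S=\Lambda_0$ is a semisimple algebra, $\Lambda$ is generated in degree $1$ (for $n\ge 2$, $\Lambda_n$ is spanned by the products of $n$ elements of $\Lambda_1$), and the left $\Lambda$-module $S=\Lambda/\bigoplus_{i\ge 1}\Lambda_i$ has a linear projective resolution: an exact sequence $$\cdots\to P^2\to P^1\to P^0\to S\to 0$$ of finitely generated graded projective left $\Lambda$-modules and graded maps of degree $0$, in which $P^i$ is generated in degree $i$ for every $i\ge 0$. -/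

import Mathlib

open scoped DirectSum

noncomputable section

/-! ## Paths and the path algebra of a quiver -/

/-- The set of all paths (of all lengths, including the trivial paths) of a quiver. -/
structure QuiverPath (V : Type*) [Quiver V] where
  {source : V}
  {target : V}
  path : Quiver.Path source target

namespace QuiverPath

variable {V : Type*} [Quiver V]

/-- The number of arrows of a path. -/
def length (p : QuiverPath V) : ℕ := p.path.length

/-- The trivial path at a vertex. -/
def vertex (v : V) : QuiverPath V := ⟨(Quiver.Path.nil : Quiver.Path v v)⟩

/-- Composition of composable paths: first `p`, then `q`. -/
def comp (p q : QuiverPath V) (h : p.target = q.source) : QuiverPath V :=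
  ⟨p.path.comp (q.path.cast h.symm rfl)⟩

/-- The arrows of a path, in the order in which they are traversed. -/
def arrowsOf {a : V} : ∀ {b : V}, Quiver.Path a b → List (Quiver.Total V)
  | _, .nil => []
  | _, .cons p e => arrowsOf p ++ [⟨_, _, e⟩]

/-- The arrows of a path, in the order in which they are traversed. -/
def arrows (p : QuiverPath V) : List (Quiver.Total V) := arrowsOf p.path

/-- The order on paths induced by a total order on the arrows: shorter paths are smaller, and
paths of the same length are compared lexicographically, from the first arrow on. -/
def Lt (o : LinearOrder (Quiver.Total V)) (p q : QuiverPath V) : Prop :=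
  List.Shortlex o.lt p.arrows q.arrows

theorem length_comp (p q : QuiverPath V) (h : p.target = q.source) :
    (p.comp q h).length = p.length + q.length := by
  obtain ⟨p⟩ := p
  obtain ⟨q⟩ := q
  dsimp at h
  subst h
  simp [comp, length]

end QuiverPath

/-- The path algebra of a quiver over `F`: the vector space with basis the set of paths. -/
def PathAlgebra (F : Type*) (V : Type*) [Field F] [Quiver V] : Type _ := QuiverPath V →₀ F

namespace PathAlgebra

variable {F V : Type*} [Field F] [Quiver V]

instance : AddCommGroup (PathAlgebra F V) := inferInstanceAs (AddCommGroup (QuiverPath V →₀ F))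

instance : Module F (PathAlgebra F V) := inferInstanceAs (Module F (QuiverPath V →₀ F))

/-- The basis element given by a path. -/
def ofPath (p : QuiverPath V) : PathAlgebra F V := Finsupp.single p (1 : F)

/-- Linear extension of a function on paths. -/
def lift {M : Type*} [AddCommGroup M] [Module F M] (f : QuiverPath V → M) :
    PathAlgebra F V →ₗ[F] M :=
  Finsupp.linearCombination F f

@[simp]
theorem lift_ofPath {M : Type*} [AddCommGroup M] [Module F M] (f : QuiverPath V → M)
    (p : QuiverPath V) : lift f (ofPath p : PathAlgebra F V) = f p := by
  simp only [lift, ofPath]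
  exact (Finsupp.linearCombination_single F (1 : F) p).trans (one_smul F (f p))

theorem hom_ext {M : Type*} [AddCommGroup M] [Module F M] {f g : PathAlgebra F V →ₗ[F] M}
    (h : ∀ p, f (ofPath p) = g (ofPath p)) : f = g :=
  Finsupp.lhom_ext' fun p => LinearMap.ext_ring (h p)

open scoped Classical in
/-- The product of two paths: their composite `pq` (first `p`, then `q`) if they are composable,
and zero otherwise. -/
def mulPath (p q : QuiverPath V) : PathAlgebra F V :=
  if h : p.target = q.source then ofPath (p.comp q h) else 0

/-- Multiplication of the path algebra, as a bilinear map. -/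
def mulHom : PathAlgebra F V →ₗ[F] PathAlgebra F V →ₗ[F] PathAlgebra F V :=
  lift fun p => lift fun q => mulPath p q

instance : Mul (PathAlgebra F V) := ⟨fun x y => mulHom x y⟩

theorem mul_def (x y : PathAlgebra F V) : x * y = mulHom x y := rfl

theorem ofPath_mul (p q : QuiverPath V) :
    (ofPath p * ofPath q : PathAlgebra F V) = mulPath p q := by
  simp [mul_def, mulHom]

theorem mulPath_assoc (p q r : QuiverPath V) :
    mulHom (mulPath p q : PathAlgebra F V) (ofPath r) = mulHom (ofPath p) (mulPath q r) := by
  obtain ⟨p⟩ := p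
  obtain ⟨q⟩ := q
  obtain ⟨r⟩ := r
  unfold mulPath
  split_ifs with h1 h2 h2
  · dsimp at h1 h2
    subst h1 h2
    simp [mulHom, mulPath, QuiverPath.comp]
  · dsimp at h1 h2
    subst h1
    simp [mulHom, mulPath, QuiverPath.comp, h2]
  · dsimp at h1 h2
    subst h2
    simp [mulHom, mulPath, QuiverPath.comp, h1]
  · simp

theorem ofPath_induction {P : PathAlgebra F V → Prop} (x : PathAlgebra F V)
    (path : ∀ p, P (ofPath p)) (zero : P 0) (add : ∀ x y, P x → P y → P (x + y))
    (smul : ∀ (c : F) x, P x → P (c • x)) : P x := by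
  refine Finsupp.induction_linear x zero (fun f g hf hg => add f g hf hg) fun p c => ?_
  have h : (Finsupp.single p c : QuiverPath V →₀ F) = c • Finsupp.single p (1 : F) := by simp
  rw [h]
  exact smul c _ (path p)

theorem mulHom_assoc (x y z : PathAlgebra F V) :
    mulHom (mulHom x y) z = mulHom x (mulHom y z) := by
  induction x using ofPath_induction with
  | zero => simp
  | add a b ha hb => simp [ha, hb]
  | smul c a ha => simp [ha]
  | path p =>
    induction y using ofPath_induction with
    | zero => simp
    | add a b ha hb => simp [ha, hb]
    | smul c a ha => simp [ha]
    | path q =>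
      induction z using ofPath_induction with
      | zero => simp
      | add a b ha hb => simp [ha, hb]
      | smul c a ha => simp [ha]
      | path r =>
        have h1 : ∀ p q : QuiverPath V,
            mulHom (ofPath p) (ofPath q) = (mulPath p q : PathAlgebra F V) :=
          fun p q => ofPath_mul p q
        rw [h1, h1, mulPath_assoc]

variable [Fintype V]

/-- The identity element is the sum of all trivial paths. -/
instance : One (PathAlgebra F V) := ⟨∑ v : V, ofPath (QuiverPath.vertex v)⟩

theorem one_def : (1 : PathAlgebra F V) = ∑ v : V, ofPath (QuiverPath.vertex v) := rfl

theorem mulHom_one_left (x : PathAlgebra F V) : mulHom 1 x = x := by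
  classical
  induction x using ofPath_induction with
  | zero => simp
  | add a b ha hb => simp [ha, hb]
  | smul c a ha => simp [ha]
  | path p =>
    obtain ⟨p⟩ := p
    rename_i a b
    simp only [one_def, map_sum, LinearMap.sum_apply]
    rw [Finset.sum_eq_single a]
    · simp [mulHom, mulPath, QuiverPath.vertex, QuiverPath.comp]
    · intro v _ hv
      simp [mulHom, mulPath, QuiverPath.vertex, hv]
    · simp

theorem mulHom_one_right (x : PathAlgebra F V) : mulHom x 1 = x := by
  classical
  induction x using ofPath_induction with
  | zero => simp
  | add a b ha hb => simp [ha, hb]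
  | smul c a ha => simp [ha]
  | path p =>
    obtain ⟨p⟩ := p
    rename_i a b
    simp only [one_def, map_sum]
    rw [Finset.sum_eq_single b]
    · simp [mulHom, mulPath, QuiverPath.vertex, QuiverPath.comp]
    · intro v _ hv
      simp [mulHom, mulPath, QuiverPath.vertex, Ne.symm hv]
    · simp

instance : Ring (PathAlgebra F V) :=
  { (inferInstance : AddCommGroup (PathAlgebra F V)) with
    mul := (· * ·)
    one := 1
    left_distrib := fun x y z => (mulHom x).map_add y z
    right_distrib := fun x y z => by simp [mul_def]
    zero_mul := fun x => by simp [mul_def]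
    mul_zero := fun x => by simp [mul_def]
    mul_assoc := mulHom_assoc
    one_mul := mulHom_one_left
    mul_one := mulHom_one_right }

instance : Algebra F (PathAlgebra F V) :=
  Algebra.ofModule (fun c x y => by simp [mul_def]) (fun c x y => by simp [mul_def])

variable (F V)

/-- The grading of the path algebra by path length. -/
def grading (n : ℕ) : Submodule F (PathAlgebra F V) :=
  Submodule.span F (ofPath '' {p : QuiverPath V | p.length = n})

variable {F V}

theorem ofPath_mem_grading (p : QuiverPath V) :
    (ofPath p : PathAlgebra F V) ∈ grading F V p.length :=
  Submodule.subset_span ⟨p, rfl, rfl⟩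

instance : SetLike.GradedMonoid (grading F V) where
  one_mem := Submodule.sum_mem _ fun v _ => ofPath_mem_grading (QuiverPath.vertex v)
  mul_mem := fun {m n} x y hx hy => by
    have key : grading F V m * grading F V n ≤ grading F V (m + n) := by
      rw [grading, grading, Submodule.span_mul_span, Submodule.span_le]
      rintro _ ⟨_, ⟨p, hp, rfl⟩, _, ⟨q, hq, rfl⟩, rfl⟩
      simp only [Set.mem_ofPred_eq] at hp hq
      subst hp hq
      simp only [ofPath_mul, mulPath]
      split_ifs with h
      · rw [← QuiverPath.length_comp p q h]
        exact ofPath_mem_grading _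
      · exact Submodule.zero_mem _
    exact key (Submodule.mul_mem_mul hx hy)

/-- The decomposition of an element of the path algebra by path length. -/
def decomposeHom : PathAlgebra F V →ₗ[F] ⨁ n, grading F V n :=
  lift fun p => DirectSum.lof F ℕ (fun n => grading F V n) p.length ⟨ofPath p, ofPath_mem_grading p⟩

theorem coe_decomposeHom (x : PathAlgebra F V) :
    DirectSum.coeLinearMap (grading F V) (decomposeHom x) = x := by
  have h : (DirectSum.coeLinearMap (grading F V)) ∘ₗ decomposeHom = LinearMap.id :=
    hom_ext fun p => by simp [decomposeHom]
  exact LinearMap.congr_fun h x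

theorem decomposeHom_of_mem {n : ℕ} (x : PathAlgebra F V) (hx : x ∈ grading F V n) :
    decomposeHom x = DirectSum.lof F ℕ (fun n => grading F V n) n ⟨x, hx⟩ := by
  induction hx using Submodule.span_induction with
  | mem x h =>
    obtain ⟨p, hp, rfl⟩ := h
    simp only [Set.mem_ofPred_eq] at hp
    subst hp
    simp [decomposeHom]
  | zero => exact (map_zero decomposeHom).trans (map_zero (DirectSum.lof F ℕ (fun n => grading F V n) n)).symm
  | add x y hx hy h1 h2 => rw [map_add, h1, h2, ← map_add]; rfl
  | smul c x hx h1 => rw [map_smul, h1, ← map_smul]; rfl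

instance : GradedAlgebra (grading F V) where
  decompose' := decomposeHom
  left_inv := coe_decomposeHom
  right_inv := fun x => by
    induction x using DirectSum.induction_on with
    | zero => simp
    | of n x =>
      exact (congrArg decomposeHom (DirectSum.coeLinearMap_lof _ _ _)).trans (decomposeHom_of_mem _ x.2)
    | add x y hx hy => simp_all

end PathAlgebra

/-! ## Quotients of graded algebras by homogeneous two-sided ideals -/

section Quotient

/-- The quotient algebra `A / I` of an algebra by a two-sided ideal. (This is Mathlib's quotient
ring, with the module structures that come from the algebra structure as the only ones.) -/
def QuotientAlgebra {A : Type*} [Ring A] (I : Ideal A) [I.IsTwoSided] : Type _ := A ⧸ I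

namespace QuotientAlgebra

variable {F A : Type*} [Field F] [Ring A] [Algebra F A] (I : Ideal A) [I.IsTwoSided]

instance : Ring (QuotientAlgebra I) := inferInstanceAs (Ring (A ⧸ I))

instance : Algebra F (QuotientAlgebra I) := inferInstanceAs (Algebra F (A ⧸ I))

variable (F) in
/-- The canonical surjection `A → A / I`. -/
def mk : A →ₐ[F] QuotientAlgebra I := Ideal.Quotient.mkₐ F I

theorem mk_surjective : Function.Surjective (mk F I) := Ideal.Quotient.mk_surjective

theorem mk_eq_zero_iff {x : A} : mk F I x = 0 ↔ x ∈ I := Ideal.Quotient.eq_zero_iff_mem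

end QuotientAlgebra

variable {F A : Type*} [Field F] [Ring A] [Algebra F A] (𝒜 : ℕ → Submodule F A) [GradedAlgebra 𝒜]
  (I : HomogeneousIdeal 𝒜) [I.toIdeal.IsTwoSided]

/-- The grading of a quotient algebra `A / I`: the images of the graded pieces of `A`. -/
def quotientGrading (n : ℕ) : Submodule F (QuotientAlgebra I.toIdeal) :=
  (𝒜 n).map (QuotientAlgebra.mk F I.toIdeal).toLinearMap

instance : SetLike.GradedMonoid (quotientGrading 𝒜 I) where
  one_mem := ⟨1, SetLike.GradedOne.one_mem, map_one (QuotientAlgebra.mk F I.toIdeal)⟩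
  mul_mem := by
    rintro m n _ _ ⟨x, hx, rfl⟩ ⟨y, hy, rfl⟩
    exact ⟨x * y, SetLike.GradedMul.mul_mem hx hy, map_mul (QuotientAlgebra.mk F I.toIdeal) x y⟩

theorem quotientGrading_isInternal : DirectSum.IsInternal (quotientGrading 𝒜 I) := by
  set π := (QuotientAlgebra.mk F I.toIdeal).toLinearMap with hπ
  let φ : ∀ n, 𝒜 n →ₗ[F] quotientGrading 𝒜 I n := fun n =>
    (π.comp (𝒜 n).subtype).codRestrict _ fun x => ⟨x, x.2, rfl⟩
  have hφ : ∀ n, Function.Surjective (φ n) := by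
    rintro n ⟨_, x, hx, rfl⟩
    exact ⟨⟨x, hx⟩, rfl⟩
  have hcomm : ∀ y, DirectSum.coeLinearMap (quotientGrading 𝒜 I) (DirectSum.lmap φ y) =
      π (DirectSum.coeLinearMap 𝒜 y) := by
    intro y
    refine LinearMap.congr_fun (f := DirectSum.coeLinearMap (quotientGrading 𝒜 I) ∘ₗ
      DirectSum.lmap φ) (g := π ∘ₗ DirectSum.coeLinearMap 𝒜) ?_ y
    ext n x
    simp [φ]
    rfl
  constructor
  · suffices h : Function.Injective (DirectSum.coeLinearMap (quotientGrading 𝒜 I)) from h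
    intro x₁ x₂ hx
    obtain ⟨y, rfl⟩ := (DirectSum.lmap_surjective φ).2 hφ x₁
    obtain ⟨z, rfl⟩ := (DirectSum.lmap_surjective φ).2 hφ x₂
    rw [hcomm, hcomm] at hx
    have h1 : DirectSum.coeLinearMap 𝒜 y - DirectSum.coeLinearMap 𝒜 z ∈ I.toIdeal := by
      refine (QuotientAlgebra.mk_eq_zero_iff (F := F) I.toIdeal).1 ?_
      rw [map_sub]
      exact sub_eq_zero.2 hx
    have h2 : ∀ y, DirectSum.decompose 𝒜 (DirectSum.coeLinearMap 𝒜 y) = y :=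
      (DirectSum.decompose 𝒜).apply_symm_apply
    refine DFinsupp.ext fun n => Subtype.ext ?_
    have h3 := I.isHomogeneous n h1
    rw [DirectSum.decompose_sub, h2, h2] at h3
    have h4 := (QuotientAlgebra.mk_eq_zero_iff (F := F) I.toIdeal).2 h3
    rw [DirectSum.sub_apply, AddSubgroupClass.coe_sub, map_sub] at h4
    exact sub_eq_zero.1 h4
  · intro a
    obtain ⟨a, rfl⟩ := QuotientAlgebra.mk_surjective (F := F) I.toIdeal a
    refine ⟨DirectSum.lmap φ (DirectSum.decompose 𝒜 a), (hcomm _).trans ?_⟩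
    exact congrArg π ((DirectSum.decompose 𝒜).symm_apply_apply a)

instance : GradedAlgebra (quotientGrading 𝒜 I) :=
  { (inferInstance : SetLike.GradedMonoid (quotientGrading 𝒜 I)),
    (quotientGrading_isInternal 𝒜 I).chooseDecomposition with }

end Quotient

/-! ## Koszul algebras -/

section Koszul

universe u

variable {F : Type*} {A : Type u} [Field F] [Ring A] [Algebra F A]

/-- A linear projective resolution of `S = 𝒜 0`, seen as a left module over the graded algebra `A`
through the projection `A → 𝒜 0`: an exact complex
`⋯ → P 2 → P 1 → P 0 → S → 0`
of finitely generated graded projective left `A`-modules and degree-zero maps, in which `P i` is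
generated in degree `i`. As `A` is graded in degrees `≥ 0`, a module generated in degree `i` lives
in degrees `≥ i`, so gradings of the modules `P i` by the natural numbers suffice. -/
structure LinearResolution (𝒜 : ℕ → Submodule F A) [GradedAlgebra 𝒜] where
  /-- the resolving modules -/
  P : ℕ → Type u
  [addCommGroup : ∀ i, AddCommGroup (P i)]
  [module : ∀ i, Module A (P i)]
  /-- `gr i n` is the part of `P i` of degree `n` -/
  gr : ∀ i : ℕ, ℕ → AddSubgroup (P i)
  isInternal : ∀ i, DirectSum.IsInternal (gr i)
  smul_mem : ∀ (i m n : ℕ) (a : A) (x : P i), a ∈ 𝒜 m → x ∈ gr i n → a • x ∈ gr i (m + n)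
  finite : ∀ i, Module.Finite A (P i)
  projective : ∀ i, Module.Projective A (P i)
  generated : ∀ i, Submodule.span A (gr i i : Set (P i)) = ⊤
  /-- the differentials -/
  d : ∀ i, P (i + 1) →ₗ[A] P i
  d_mem : ∀ (i n : ℕ) (x : P (i + 1)), x ∈ gr (i + 1) n → d i x ∈ gr i n
  /-- the augmentation; being semilinear along the projection `A → 𝒜 0` means being linear for
  the `A`-module structure of `S = 𝒜 0` -/
  ε : P 0 →ₛₗ[GradedRing.projZeroRingHom' 𝒜] 𝒜 0
  ε_degree : ∀ (n : ℕ) (x : P 0), n ≠ 0 → x ∈ gr 0 n → ε x = 0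
  ε_surjective : Function.Surjective ε
  exact_zero : Function.Exact (d 0) ε
  exact_succ : ∀ i, Function.Exact (d (i + 1)) (d i)

/-- A graded algebra `A`, graded by `𝒜 0, 𝒜 1, …`, is Koszul if `𝒜 0` is semisimple, `A` is
generated in degree one and `𝒜 0` has a linear projective resolution. -/
structure IsKoszul (𝒜 : ℕ → Submodule F A) [GradedAlgebra 𝒜] : Prop where
  isSemisimpleRing : IsSemisimpleRing (𝒜 0)
  generated : ∀ n, 2 ≤ n → 𝒜 1 ^ n = 𝒜 n
  linearResolution : Nonempty (LinearResolution 𝒜)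

end Koszul

/-! ## PBW bases of quotients of path algebras -/

section PBW

variable {F V : Type*} [Field F] [Quiver V] [Fintype V]

/-- The image in `F Q / I` of a path. -/
def pathClass (I : Ideal (PathAlgebra F V)) [I.IsTwoSided] (p : QuiverPath V) :
    QuotientAlgebra I :=
  QuotientAlgebra.mk F I (PathAlgebra.ofPath p)

/-- `(B, <)` is a PBW basis of `F Q / I`, where `B` is a set of paths and `<` a total order `o` on
the arrows, extended to the paths: length first, then lexicographically. -/
structure IsPBWBasis (I : Ideal (PathAlgebra F V)) [I.IsTwoSided]
    (o : LinearOrder (Quiver.Total V)) (B : Set (QuiverPath V)) : Prop where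
  /-- `B` is a basis of `F Q / I`: linear independence -/
  linearIndependent : LinearIndependent F fun p : B => pathClass I p
  /-- `B` is a basis of `F Q / I`: it spans -/
  span_eq_top : Submodule.span F (pathClass I '' B) = ⊤
  /-- A product of two elements of `B` is in `B` or a linear combination of smaller elements of
  `B`. (For paths that are not composable, the product is zero and there is nothing to ask.) -/
  mul_mem_or : ∀ p ∈ B, ∀ q ∈ B, ∀ h : p.target = q.source,
    p.comp q h ∈ B ∨
      pathClass I (p.comp q h) ∈
        Submodule.span F (pathClass I '' {r | r ∈ B ∧ QuiverPath.Lt o r (p.comp q h)})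
  /-- A path of length at least three is in `B` if and only if, whenever it is cut into two
  nontrivial paths, both of them are in `B`. -/
  mem_iff : ∀ w : QuiverPath V, 3 ≤ w.length →
    (w ∈ B ↔ ∀ (p q : QuiverPath V) (h : p.target = q.source), 0 < p.length → 0 < q.length →
      p.comp q h = w → p ∈ B ∧ q ∈ B)

end PBW

end

/-! Write Λ for the quotient algebra. The resolution is built from chains, the paths none of whose
length-two factors lies in `B`. Its term in position `i` is the direct sum of the modules Λe_v[c],
over chains `c` of length `i` starting at `v`. It is projective, finitely generated because there
are finitely many paths of each length, and generated in degree `i`, so linearity is built in.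
Everything rests on producing exact differentials.

Over the field this term has the basis of elements `w[c]` with `w ∈ B` and `wc` composable, and such
an element is labelled by the path `wc`. Labels of equal length are compared lexicographically. The
differentials have the shape `[ac] ↦ a[c] + smaller terms` for an arrow `a`, so `w[ac]` goes to
`wa[c]` up to smaller labels. If `wa ∈ B`, this is a basis element with the same label. If `wa ∉ B`,
the PBW condition on products rewrites it by strictly smaller ones
(`IsPBWBasis.pathClass_mem_span_homLe`).

Exactness follows by descending on the leading label of a cycle (`exists_preimage_of_leading`). A
leading term `w[αc]` with `wα ∈ B` would survive in the boundary, so `wα ∉ B`. Write `w = uβ` with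
`β` an arrow. Since membership in `B` is decided by length-two factors (`IsPBWBasis.cat_cat_mem`),
`βα ∉ B`. Hence `βαc` is a chain, and subtracting a multiple of the boundary of `u[βαc]` removes the
leading term.

The differentials are found inductively (`IsResolutionStep.exists_next`). For a chain `bac`, the
previous differential sends `b[ac]` to strictly smaller labels. Exactness with control of labels
corrects `b[ac]` by smaller terms to a cycle, which becomes the image of `[bac]`. This is why
exactness is carried along for every set of labels closed downwards in fixed length, not only for
the whole module. -/

open scoped DirectSum

noncomputable section

/-! ### Concatenation and unique factorisation of paths -/

namespace QuiverPath

variable {V : Type*} [Quiver V]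

/-- Concatenation of two paths, with the junk value `p` if they are not composable. -/
def cat (p q : QuiverPath V) : QuiverPath V :=
  open scoped Classical in if h : p.target = q.source then p.comp q h else p

infixl:75 " ⋆ " => QuiverPath.cat

theorem cat_eq_comp (p q : QuiverPath V) (h : p.target = q.source) : p ⋆ q = p.comp q h :=
  dif_pos h

@[simp] theorem source_cat (p q : QuiverPath V) : (p ⋆ q).source = p.source := by
  unfold cat
  split_ifs <;> rfl

theorem target_cat {p q : QuiverPath V} (h : p.target = q.source) :
    (p ⋆ q).target = q.target := by
  rw [cat_eq_comp p q h]
  rfl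

theorem length_cat {p q : QuiverPath V} (h : p.target = q.source) :
    (p ⋆ q).length = p.length + q.length := by
  rw [cat_eq_comp p q h, length_comp]

@[simp] theorem length_vertex (v : V) : (vertex v).length = 0 := rfl

@[simp] theorem source_vertex (v : V) : (vertex v).source = v := rfl

@[simp] theorem target_vertex (v : V) : (vertex v).target = v := rfl

theorem cat_assoc {p q r : QuiverPath V} (h : p.target = q.source) (h' : q.target = r.source) :
    p ⋆ q ⋆ r = p ⋆ (q ⋆ r) := by
  rw [cat_eq_comp (p ⋆ q) r ((target_cat h).trans h'),
    cat_eq_comp p (q ⋆ r) (h.trans (source_cat q r).symm)]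
  simp only [cat_eq_comp p q h, cat_eq_comp q r h']
  obtain ⟨p⟩ := p
  obtain ⟨q⟩ := q
  obtain ⟨r⟩ := r
  dsimp at h h'
  subst h h'
  simp [comp]

@[simp] theorem vertex_cat (p : QuiverPath V) : vertex p.source ⋆ p = p := by
  rw [cat_eq_comp _ _ rfl]
  obtain ⟨p⟩ := p
  simp [comp, vertex]

@[simp] theorem cat_vertex (p : QuiverPath V) (v : V) : p ⋆ vertex v = p := by
  by_cases h : p.target = v
  · subst h
    rw [cat_eq_comp _ _ rfl]
    obtain ⟨p⟩ := p
    simp [comp, vertex]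
  · exact dif_neg h

theorem length_arrowsOf {a b : V} (p : Quiver.Path a b) : (arrowsOf p).length = p.length := by
  induction p with
  | nil => rfl
  | cons p e ih => simp [arrowsOf, ih]

@[simp] theorem length_arrows (p : QuiverPath V) : p.arrows.length = p.length :=
  length_arrowsOf p.path

theorem arrowsOf_comp {a b c : V} (p : Quiver.Path a b) (q : Quiver.Path b c) :
    arrowsOf (p.comp q) = arrowsOf p ++ arrowsOf q := by
  induction q with
  | nil => simp [arrowsOf]
  | cons q e ih => simp [arrowsOf, ih]

theorem arrows_cat {p q : QuiverPath V} (h : p.target = q.source) :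
    (p ⋆ q).arrows = p.arrows ++ q.arrows := by
  rw [cat_eq_comp p q h]
  obtain ⟨p⟩ := p
  obtain ⟨q⟩ := q
  dsimp at h
  subst h
  simp [comp, arrows, arrowsOf_comp]

theorem eq_of_arrowsOf {a b b' : V} (p : Quiver.Path a b) (q : Quiver.Path a b')
    (h : arrowsOf p = arrowsOf q) : (⟨p⟩ : QuiverPath V) = ⟨q⟩ := by
  induction p generalizing b' with
  | nil =>
    cases q with
    | nil => rfl
    | cons q e => simp [arrowsOf] at h
  | cons p e ih =>
    cases q with
    | nil => simp [arrowsOf] at h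
    | cons q f =>
      simp only [arrowsOf] at h
      obtain ⟨h1, h2⟩ := List.append_inj' h rfl
      have h3 := ih q h1
      simp only [List.cons.injEq, and_true] at h2
      injection h2 with h4 h5 h6
      subst h4 h5
      cases h6
      injection h3 with _ _ h7
      cases h7
      rfl

/-- The source has to be prescribed because all trivial paths share the empty list of arrows. -/
theorem eq_of_arrows (p q : QuiverPath V) (hs : p.source = q.source) (h : p.arrows = q.arrows) :
    p = q := by
  obtain ⟨p⟩ := p
  obtain ⟨q⟩ := q
  dsimp at hs
  subst hs
  exact eq_of_arrowsOf p q h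

theorem source_eq_of_arrowsOf {a a' b b' : V} (p : Quiver.Path a b) (q : Quiver.Path a' b')
    (h : arrowsOf p = arrowsOf q) (hp : 0 < p.length) : a = a' := by
  induction p generalizing b' with
  | nil => simp at hp
  | cons p e ih =>
    cases q with
    | nil => simp [arrowsOf] at h
    | cons q f =>
      simp only [arrowsOf] at h
      obtain ⟨h1, h2⟩ := List.append_inj' h rfl
      rcases Nat.eq_zero_or_pos p.length with h0 | h0
      · have h3 : q.length = 0 := by rw [← length_arrowsOf, ← h1, length_arrowsOf, h0]
        obtain rfl := Quiver.Path.eq_of_length_zero p h0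
        obtain rfl := Quiver.Path.eq_of_length_zero q h3
        simp only [List.cons.injEq, and_true] at h2
        injection h2
      · exact ih q h1 h0

/-- Paths of positive length are determined by their arrows. -/
theorem eq_of_arrows_of_pos (p q : QuiverPath V) (hp : 0 < p.length) (h : p.arrows = q.arrows) :
    p = q :=
  eq_of_arrows p q (source_eq_of_arrowsOf p.path q.path h hp) h

theorem cat_inj {p q p' q' : QuiverPath V} (h : p.target = q.source) (h' : p'.target = q'.source)
    (e : p ⋆ q = p' ⋆ q') (hl : p.length = p'.length) : p = p' ∧ q = q' := by
  have h1 : p.arrows ++ q.arrows = p'.arrows ++ q'.arrows := by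
    rw [← arrows_cat h, ← arrows_cat h', e]
  obtain ⟨h2, h3⟩ := List.append_inj h1 (by simpa using hl)
  have hs : p.source = p'.source := by rw [← source_cat p q, e, source_cat]
  obtain rfl := eq_of_arrows p p' hs h2
  exact ⟨rfl, eq_of_arrows q q' (h.symm.trans h') h3⟩

theorem cat_inj' {p q p' q' : QuiverPath V} (h : p.target = q.source) (h' : p'.target = q'.source)
    (e : p ⋆ q = p' ⋆ q') (hl : q.length = q'.length) : p = p' ∧ q = q' := by
  refine cat_inj h h' e ?_
  have := length_cat h
  rw [e, length_cat h'] at this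
  omega

theorem eq_vertex_of_length_eq_zero {p : QuiverPath V} (h : p.length = 0) :
    p = vertex p.source :=
  eq_of_arrows _ _ rfl (by
    rw [List.eq_nil_of_length_eq_zero (by simpa using h : p.arrows.length = 0)]
    rfl)

theorem exists_cat_of_le_length {a b : V} (p : Quiver.Path a b) : ∀ k ≤ p.length,
    ∃ u v : QuiverPath V, u.target = v.source ∧ u.length = k ∧ u ⋆ v = ⟨p⟩ := by
  induction p with
  | nil =>
    exact fun k hk => ⟨vertex a, vertex a, rfl, by simp_all, cat_vertex _ _⟩
  | @cons b c p e ih =>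
    intro k hk
    rcases hk.lt_or_eq with hk | hk
    · obtain ⟨u, v, h, hu, huv⟩ := ih k (by simpa [Nat.lt_succ_iff] using hk)
      have ht : v.target = b := by rw [← target_cat h, huv]
      refine ⟨u, v ⋆ ⟨e.toPath⟩, h.trans (source_cat _ _).symm, hu, ?_⟩
      rw [← cat_assoc h ht, huv, cat_eq_comp _ _ rfl]
      rfl
    · exact ⟨⟨p.cons e⟩, vertex c, rfl, hk.symm, cat_vertex _ _⟩

theorem exists_cat_of_le {p : QuiverPath V} {k : ℕ} (hk : k ≤ p.length) :
    ∃ u v : QuiverPath V, u.target = v.source ∧ u.length = k ∧ u ⋆ v = p :=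
  exists_cat_of_le_length p.path k hk

theorem exists_cat_of_le' {p : QuiverPath V} {k : ℕ} (hk : k ≤ p.length) :
    ∃ u v : QuiverPath V, u.target = v.source ∧ v.length = k ∧ u ⋆ v = p := by
  obtain ⟨u, v, h, hu, rfl⟩ := exists_cat_of_le (Nat.sub_le p.length k)
  have := length_cat h
  exact ⟨u, v, h, by omega, rfl⟩

theorem finite_length_eq [Finite V] [Finite (Quiver.Total V)] (n : ℕ) :
    {p : QuiverPath V | p.length = n}.Finite := by
  refine Set.Finite.of_finite_image (f := fun p => (p.source, p.arrows)) ?_ ?_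
  · refine (Set.finite_univ.prod (List.finite_length_eq (Quiver.Total V) n)).subset ?_
    rintro _ ⟨p, hp, rfl⟩
    exact ⟨trivial, (length_arrows p).trans hp⟩
  · intro p _ q _ h
    exact eq_of_arrows p q (congrArg Prod.fst h) (congrArg Prod.snd h)

/-! ### The length-lexicographic order on paths -/

section order

variable (o : LinearOrder (Quiver.Total V))

/-- The order on paths, restricted to paths of equal length. -/
def HomLt (p q : QuiverPath V) : Prop := p.length = q.length ∧ Lt o p q

/-- The reflexive closure of `HomLt`. -/
def HomLe (p q : QuiverPath V) : Prop := p = q ∨ HomLt o p q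

variable {o}

theorem Lt.irrefl (p : QuiverPath V) : ¬ Lt o p p := fun h =>
  let _ := o
  Std.Asymm.asymm (r := List.Shortlex (α := Quiver.Total V) (· < ·)) _ _ h h

theorem Lt.trans {p q r : QuiverPath V} (h : Lt o p q) (h' : Lt o q r) : Lt o p r := by
  let _ := o
  have h1 := List.shortlex_def.1 h
  have h2 := List.shortlex_def.1 h'
  refine List.shortlex_def.2 ?_
  rcases h1 with h1 | ⟨e1, h1⟩ <;> rcases h2 with h2 | ⟨e2, h2⟩
  · exact Or.inl (h1.trans h2)
  · exact Or.inl (e2 ▸ h1)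
  · exact Or.inl (e1 ▸ h2)
  · exact Or.inr ⟨e1.trans e2, lt_trans (α := List (Quiver.Total V)) h1 h2⟩

theorem HomLt.trans {p q r : QuiverPath V} (h : HomLt o p q) (h' : HomLt o q r) : HomLt o p r :=
  ⟨h.1.trans h'.1, h.2.trans h'.2⟩

theorem HomLe.trans_lt {p q r : QuiverPath V} (h : HomLe o p q) (h' : HomLt o q r) :
    HomLt o p r := by
  rcases h with rfl | h
  · exact h'
  · exact h.trans h'

theorem HomLe.trans {p q r : QuiverPath V} (h : HomLe o p q) (h' : HomLe o q r) :
    HomLe o p r := by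
  rcases h' with rfl | h'
  · exact h
  · exact Or.inr (h.trans_lt h')

/-- With finitely many arrows the order on letters is well founded, and the shortlex order inherits
this. It licenses the descent on leading labels. -/
theorem Lt.wf [Finite (Quiver.Total V)] : WellFounded (Lt o) :=
  let _ := o
  InvImage.wf arrows (List.Shortlex.wf (r := (· < ·)) wellFounded_lt)

/-- Distinct trivial paths are incomparable, so positive length is essential. -/
theorem Lt.trichotomous (p q : QuiverPath V) (hp : 0 < p.length) :
    Lt o p q ∨ p = q ∨ Lt o q p := by
  let _ := o
  by_contra! h
  exact h.2.1 (eq_of_arrows_of_pos p q hp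
    (Std.Trichotomous.trichotomous (r := List.Shortlex (α := Quiver.Total V) (· < ·)) _ _
      h.1 h.2.2))

/-- Lists of equal length are compared at their first difference, which survives appending. A proper
prefix would have no such difference, and appending could then reverse the order. -/
theorem lex_append_right {α : Type*} {r : α → α → Prop} {s t : List α} (h : List.Lex r s t)
    (hl : s.length = t.length) (u : List α) : List.Lex r (s ++ u) (t ++ u) := by
  induction h with
  | nil => simp at hl
  | cons h ih => exact List.Lex.cons (ih (by simpa using hl))
  | rel h => exact List.Lex.rel h

theorem HomLt.cat_right {p q r : QuiverPath V} (h : HomLt o p q)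
    (hp : p.target = r.source) (hq : q.target = r.source) : HomLt o (p ⋆ r) (q ⋆ r) := by
  refine ⟨by rw [length_cat hp, length_cat hq, h.1], ?_⟩
  have hl : p.arrows.length = q.arrows.length := by simpa using h.1
  have h2 := (List.shortlex_iff_lex hl).1 h.2
  unfold Lt
  rw [arrows_cat hp, arrows_cat hq]
  exact List.Shortlex.of_lex (by simpa using h.1) (lex_append_right h2 hl _)

theorem HomLt.cat_left {p q r : QuiverPath V} (h : HomLt o p q)
    (hp : r.target = p.source) (hq : r.target = q.source) : HomLt o (r ⋆ p) (r ⋆ q) := by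
  refine ⟨by rw [length_cat hp, length_cat hq, h.1], ?_⟩
  unfold Lt
  rw [arrows_cat hp, arrows_cat hq]
  exact List.Shortlex.append_left h.2 _

theorem HomLe.cat_right {p q r : QuiverPath V} (h : HomLe o p q)
    (hp : p.target = r.source) (hq : q.target = r.source) : HomLe o (p ⋆ r) (q ⋆ r) := by
  rcases h with rfl | h
  · exact Or.inl rfl
  · exact Or.inr (h.cat_right hp hq)

end order

/-! ### Chains -/

/-- A path is a chain relative to a set of paths `B` if none of its factors of length two
belongs to `B`. -/
def IsChain (B : Set (QuiverPath V)) (c : QuiverPath V) : Prop :=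
  ∀ u q v : QuiverPath V, u.target = q.source → q.target = v.source →
    q.length = 2 → u ⋆ (q ⋆ v) = c → q ∉ B

variable {B : Set (QuiverPath V)} {a b c : QuiverPath V}

theorem IsChain.of_length_le_one (h : c.length ≤ 1) : IsChain B c := by
  rintro u q v h1 h2 hq rfl
  rw [length_cat (h1.trans (source_cat q v).symm), length_cat h2] at h
  omega

theorem IsChain.of_cat (h : a.target = c.source) (hc : IsChain B (a ⋆ c)) : IsChain B c := by
  rintro u q v h1 h2 hq rfl
  rw [source_cat] at h
  exact hc (a ⋆ u) q v ((target_cat h).trans h1) h2 hq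
    (cat_assoc h (h1.trans (source_cat q v).symm))

theorem IsChain.notMem (h : b.target = a.source) (h' : a.target = c.source)
    (hc : IsChain B (b ⋆ (a ⋆ c))) (ha : a.length = 1) (hb : b.length = 1) : b ⋆ a ∉ B := by
  refine hc (vertex b.source) (b ⋆ a) c (source_cat b a).symm ((target_cat h).trans h')
    (by rw [length_cat h, ha, hb]) ?_
  rw [cat_assoc h h']
  simpa using vertex_cat (b ⋆ (a ⋆ c))

/-- A length-two factor of `bac` is either the initial `ba` or already a factor of `ac`. -/
theorem IsChain.cat (h : b.target = a.source) (h' : a.target = c.source)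
    (hc : IsChain B (a ⋆ c)) (ha : a.length = 1) (hb : b.length = 1) (hab : b ⋆ a ∉ B) :
    IsChain B (b ⋆ (a ⋆ c)) := by
  intro u q v h1 h2 hq e
  rcases Nat.eq_zero_or_pos u.length with h0 | h0
  · rw [eq_vertex_of_length_eq_zero h0] at e h1
    rw [show u.source = (q ⋆ v).source from h1.trans (source_cat q v).symm, vertex_cat,
      ← cat_assoc h h'] at e
    obtain ⟨rfl, -⟩ := cat_inj h2 ((target_cat h).trans h') e
      (by rw [length_cat h, hq, ha, hb])
    exact hab
  · obtain ⟨b', u, h3, hb', rfl⟩ := exists_cat_of_le h0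
    rw [target_cat h3] at h1
    rw [cat_assoc h3 (h1.trans (source_cat q v).symm)] at e
    obtain ⟨-, e⟩ := cat_inj (h3.trans (source_cat _ _).symm) (h.trans (source_cat _ _).symm) e
      (by omega)
    exact hc u q v h1 h2 hq e

end QuiverPath

open QuiverPath

/-! ### Classes of paths modulo the ideal -/

section PathClass

variable {F V : Type*} [Field F] [Quiver V] [Fintype V]

theorem pathClass_mul (J : Ideal (PathAlgebra F V)) [J.IsTwoSided] {p q : QuiverPath V}
    (h : p.target = q.source) : pathClass J p * pathClass J q = pathClass J (p ⋆ q) := by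
  rw [pathClass, pathClass, ← map_mul, PathAlgebra.ofPath_mul, PathAlgebra.mulPath, dif_pos h,
    cat_eq_comp p q h, pathClass]

theorem pathClass_mul_of_ne (J : Ideal (PathAlgebra F V)) [J.IsTwoSided] {p q : QuiverPath V}
    (h : p.target ≠ q.source) : pathClass J p * pathClass J q = 0 := by
  rw [pathClass, pathClass, ← map_mul, PathAlgebra.ofPath_mul, PathAlgebra.mulPath, dif_neg h,
    map_zero]

theorem pathClass_mul_vertex (J : Ideal (PathAlgebra F V)) [J.IsTwoSided] (p : QuiverPath V) :
    pathClass J p * pathClass J (vertex p.target) = pathClass J p := by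
  rw [pathClass_mul J rfl, cat_vertex]

theorem vertex_mul_pathClass (J : Ideal (PathAlgebra F V)) [J.IsTwoSided] (p : QuiverPath V) :
    pathClass J (vertex p.source) * pathClass J p = pathClass J p := by
  rw [pathClass_mul J rfl, vertex_cat]

theorem one_eq_sum_pathClass (J : Ideal (PathAlgebra F V)) [J.IsTwoSided] :
    (1 : QuotientAlgebra J) = ∑ v : V, pathClass J (vertex v) := by
  simp only [pathClass]
  rw [← map_sum, ← PathAlgebra.one_def, map_one]

variable (I : HomogeneousIdeal (PathAlgebra.grading F V)) [I.toIdeal.IsTwoSided]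

theorem quotientGrading_eq_span (n : ℕ) :
    quotientGrading (PathAlgebra.grading F V) I n =
      Submodule.span F (pathClass I.toIdeal '' {p | p.length = n}) := by
  rw [quotientGrading, PathAlgebra.grading, Submodule.map_span, ← Set.image_comp]
  rfl

theorem span_range_pathClass :
    Submodule.span F (Set.range (pathClass I.toIdeal)) = ⊤ := by
  rw [eq_top_iff]
  rintro x -
  obtain ⟨x, rfl⟩ := QuotientAlgebra.mk_surjective (F := F) I.toIdeal x
  induction x using PathAlgebra.ofPath_induction with
  | zero => simp
  | add a b ha hb => rw [map_add]; exact add_mem ha hb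
  | smul c a ha => rw [map_smul]; exact Submodule.smul_mem _ c ha
  | path p => exact Submodule.subset_span ⟨p, rfl⟩

theorem pathClass_mem_grading (p : QuiverPath V) :
    pathClass I.toIdeal p ∈ quotientGrading (PathAlgebra.grading F V) I p.length := by
  rw [quotientGrading_eq_span]
  exact Submodule.subset_span ⟨p, rfl, rfl⟩

theorem proj_pathClass_of_eq {p : QuiverPath V} {n : ℕ} (h : p.length = n) :
    GradedAlgebra.proj (quotientGrading (PathAlgebra.grading F V) I) n (pathClass I.toIdeal p) =
      pathClass I.toIdeal p := by
  rw [GradedAlgebra.proj_apply]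
  exact DirectSum.decompose_of_mem_same _ (h ▸ pathClass_mem_grading I p)

theorem proj_pathClass_of_ne {p : QuiverPath V} {n : ℕ} (h : p.length ≠ n) :
    GradedAlgebra.proj (quotientGrading (PathAlgebra.grading F V) I) n (pathClass I.toIdeal p) =
      0 := by
  rw [GradedAlgebra.proj_apply]
  exact DirectSum.decompose_of_mem_ne _ (pathClass_mem_grading I p) h

/-- The projection of `F Q / I` onto the part of degree `n` spanned by the paths from `s` to
`t`. -/
def homPart (s t : V) (n : ℕ) : QuotientAlgebra I.toIdeal →ₗ[F] QuotientAlgebra I.toIdeal :=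
  GradedAlgebra.proj (quotientGrading (PathAlgebra.grading F V) I) n ∘ₗ
    LinearMap.mulRight F (pathClass I.toIdeal (vertex t)) ∘ₗ
    LinearMap.mulLeft F (pathClass I.toIdeal (vertex s))

theorem homPart_apply (s t : V) (n : ℕ) (x : QuotientAlgebra I.toIdeal) :
    homPart I s t n x = GradedAlgebra.proj (quotientGrading (PathAlgebra.grading F V) I) n
      (pathClass I.toIdeal (vertex s) * x * pathClass I.toIdeal (vertex t)) := rfl

theorem homPart_pathClass (p : QuiverPath V) :
    homPart I p.source p.target p.length (pathClass I.toIdeal p) = pathClass I.toIdeal p := by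
  rw [homPart_apply, vertex_mul_pathClass, pathClass_mul_vertex, proj_pathClass_of_eq I rfl]

theorem homPart_pathClass_of_ne {s t : V} {n : ℕ} {p : QuiverPath V}
    (h : ¬ (p.source = s ∧ p.target = t ∧ p.length = n)) :
    homPart I s t n (pathClass I.toIdeal p) = 0 := by
  rw [homPart_apply]
  by_cases hs : s = p.source
  · subst hs
    rw [vertex_mul_pathClass]
    by_cases ht : p.target = t
    · subst ht
      rw [pathClass_mul_vertex, proj_pathClass_of_ne]
      tauto
    · rw [pathClass_mul_of_ne _ (by simpa using ht), map_zero]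
  · rw [pathClass_mul_of_ne _ (by simpa using hs), zero_mul, map_zero]

variable {I}

/-- If a path is a linear combination of paths in `S`, it is one of parallel paths of the same
length in `S`. -/
theorem pathClass_mem_span_parallel {p : QuiverPath V} {S : Set (QuiverPath V)}
    (h : pathClass I.toIdeal p ∈ Submodule.span F (pathClass I.toIdeal '' S)) :
    pathClass I.toIdeal p ∈ Submodule.span F (pathClass I.toIdeal ''
      {r | r ∈ S ∧ r.source = p.source ∧ r.target = p.target ∧ r.length = p.length}) := by
  -- This projection fixes the class of `p` and kills the class of every path that is not parallel
  -- to `p` of the same length.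
  have h1 := Submodule.mem_map_of_mem (f := homPart I p.source p.target p.length) h
  rw [homPart_pathClass, Submodule.map_span] at h1
  refine Submodule.span_le.2 ?_ h1
  rintro _ ⟨_, ⟨r, hr, rfl⟩, rfl⟩
  by_cases h2 : r.source = p.source ∧ r.target = p.target ∧ r.length = p.length
  · obtain ⟨h3, h4, h5⟩ := h2
    rw [← h3, ← h4, ← h5, homPart_pathClass]
    exact Submodule.subset_span ⟨r, ⟨hr, rfl, rfl, rfl⟩, rfl⟩
  · rw [homPart_pathClass_of_ne I h2]
    exact zero_mem _

/-- The paths of length at most one remain linearly independent modulo `I`. -/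
theorem mem_of_pathClass_mem_span
    (hI : ∀ x ∈ I.toIdeal,
      x ∈ Submodule.span F
        ((PathAlgebra.ofPath : QuiverPath V → PathAlgebra F V) '' {p | 2 ≤ p.length}))
    {p : QuiverPath V} (hp : p.length ≤ 1) {S : Set (QuiverPath V)}
    (h : pathClass I.toIdeal p ∈ Submodule.span F (pathClass I.toIdeal '' S)) : p ∈ S := by
  have h1 : pathClass I.toIdeal '' S = (QuotientAlgebra.mk F I.toIdeal).toLinearMap ''
      ((PathAlgebra.ofPath : QuiverPath V → PathAlgebra F V) '' S) := by
    rw [← Set.image_comp]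
    rfl
  rw [h1, ← Submodule.map_span] at h
  obtain ⟨y, hy, hyp⟩ := h
  -- Lifted to the path algebra, the relation changes only by terms of length at least two.
  -- Independence of paths there then forces `p ∈ S`.
  have h2 : (PathAlgebra.ofPath p : PathAlgebra F V) - y ∈ I.toIdeal := by
    refine (QuotientAlgebra.mk_eq_zero_iff (F := F) I.toIdeal).1 ?_
    rw [map_sub]
    exact sub_eq_zero.2 hyp.symm
  have h3 : (PathAlgebra.ofPath p : PathAlgebra F V) ∈ Submodule.span F
      ((PathAlgebra.ofPath : QuiverPath V → PathAlgebra F V) '' (S ∪ {p | 2 ≤ p.length})) := by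
    rw [← sub_add_cancel (PathAlgebra.ofPath p : PathAlgebra F V) y]
    exact add_mem (Submodule.span_mono (Set.image_mono Set.subset_union_right) (hI _ h2))
      (Submodule.span_mono (Set.image_mono Set.subset_union_left) hy)
  have hli : LinearIndependent F (PathAlgebra.ofPath : QuiverPath V → PathAlgebra F V) :=
    Finsupp.linearIndependent_single_one F (QuiverPath V)
  have h4 : p ∈ S ∪ {p | 2 ≤ p.length} := by
    by_contra h5
    exact hli.notMem_span_image h5 h3
  rcases h4 with h4 | h4
  · exact h4
  · have : 2 ≤ p.length := h4
    omega

end PathClass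

/-! ### Consequences of the PBW conditions -/

namespace IsPBWBasis

variable {F V : Type*} [Field F] [Quiver V] [Fintype V]
  {I : HomogeneousIdeal (PathAlgebra.grading F V)} [I.toIdeal.IsTwoSided]
  {o : LinearOrder (Quiver.Total V)} {B : Set (QuiverPath V)}

theorem mem_of_length_le_one (hB : IsPBWBasis I.toIdeal o B)
    (hI : ∀ x ∈ I.toIdeal,
      x ∈ Submodule.span F
        ((PathAlgebra.ofPath : QuiverPath V → PathAlgebra F V) '' {p | 2 ≤ p.length}))
    {p : QuiverPath V} (hp : p.length ≤ 1) : p ∈ B :=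
  mem_of_pathClass_mem_span hI hp (hB.span_eq_top ▸ Submodule.mem_top)

theorem cat_mem_iff (hB : IsPBWBasis I.toIdeal o B) {p q : QuiverPath V}
    (h3 : 3 ≤ (p ⋆ q).length) :
    p ⋆ q ∈ B ↔ ∀ p' q' : QuiverPath V, p'.target = q'.source → 0 < p'.length → 0 < q'.length →
      p' ⋆ q' = p ⋆ q → p' ∈ B ∧ q' ∈ B := by
  rw [hB.mem_iff _ h3]
  constructor
  · intro H p' q' h' hp hq e
    exact H p' q' h' hp hq (by rw [← cat_eq_comp _ _ h', e])
  · intro H p' q' h' hp hq e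
    exact H p' q' h' hp hq (by rw [← e, cat_eq_comp _ _ h'])

/-- Factors of elements of `B` are in `B`. -/
theorem mem_of_cat_mem (hB : IsPBWBasis I.toIdeal o B)
    (hI : ∀ p : QuiverPath V, p.length ≤ 1 → p ∈ B) {p q : QuiverPath V}
    (h : p.target = q.source) (hpq : p ⋆ q ∈ B) : p ∈ B ∧ q ∈ B := by
  rcases Nat.eq_zero_or_pos p.length with hp | hp
  · refine ⟨hI p (by omega), ?_⟩
    rw [eq_vertex_of_length_eq_zero hp] at hpq h
    rwa [show p.source = q.source from h, vertex_cat] at hpq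
  rcases Nat.eq_zero_or_pos q.length with hq | hq
  · refine ⟨?_, hI q (by omega)⟩
    rwa [eq_vertex_of_length_eq_zero hq, cat_vertex] at hpq
  by_cases h3 : 3 ≤ (p ⋆ q).length
  · exact (hB.cat_mem_iff h3).1 hpq p q h hp hq rfl
  · rw [length_cat h] at h3
    exact ⟨hI p (by omega), hI q (by omega)⟩

/-- Membership of a path in `B` depends only on its factors of length two. -/
theorem cat_cat_mem (hB : IsPBWBasis I.toIdeal o B)
    (hI : ∀ p : QuiverPath V, p.length ≤ 1 → p ∈ B) {a b : QuiverPath V}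
    (ha : a.length = 1) (hb : b.length = 1) (hba : b.target = a.source) (hm : b ⋆ a ∈ B)
    {w : QuiverPath V} (h : w.target = b.source) (hw : w ⋆ b ∈ B) : w ⋆ (b ⋆ a) ∈ B := by
  induction hn : w.length using Nat.strong_induction_on generalizing w with
  | _ n ih =>
  have h' : w.target = (b ⋆ a).source := h.trans (source_cat _ _).symm
  rcases Nat.eq_zero_or_pos w.length with h0 | h0
  · rw [eq_vertex_of_length_eq_zero h0] at h' ⊢
    rwa [show w.source = (b ⋆ a).source from h', vertex_cat]
  have hl := length_cat h'
  rw [length_cat hba] at hl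
  refine (hB.cat_mem_iff (by omega)).2 fun p q hpq hp hq e => ?_
  have hl' := length_cat hpq
  rw [e] at hl'
  -- For any cut of `wba`, the right part ends in `a`. Either it is `a` itself, or it has the form
  -- `q''ba` with `q''` shorter than `w`, and induction applies.
  obtain ⟨q', x, h1, hx, rfl⟩ := exists_cat_of_le' (p := q) (k := 1) hq
  rw [source_cat] at hpq
  rw [← cat_assoc hpq h1, ← cat_assoc h hba] at e
  obtain ⟨e', rfl⟩ := cat_inj' ((target_cat hpq).trans h1) ((target_cat h).trans hba) e
    (hx.trans ha.symm)
  rcases Nat.eq_zero_or_pos q'.length with h2 | h2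
  · rw [eq_vertex_of_length_eq_zero h2] at e' h1 ⊢
    rw [cat_vertex] at e'
    subst e'
    rw [show q'.source = x.source from h1, vertex_cat]
    exact ⟨hw, hI _ (by omega)⟩
  · obtain ⟨q'', y, h3, hy, rfl⟩ := exists_cat_of_le' (p := q') (k := 1) h2
    rw [source_cat] at hpq
    rw [target_cat h3] at h1
    rw [← cat_assoc hpq h3] at e'
    obtain ⟨rfl, rfl⟩ := cat_inj' ((target_cat hpq).trans h3) h e' (hy.trans hb.symm)
    rw [cat_assoc hpq h3] at hw
    refine ⟨(hB.mem_of_cat_mem hI (hpq.trans (source_cat _ _).symm) hw).1, ?_⟩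
    rw [cat_assoc h3 h1]
    refine ih q''.length ?_ h3
      (hB.mem_of_cat_mem hI (hpq.trans (source_cat _ _).symm) hw).2 rfl
    rw [← hn, length_cat hpq]
    omega

/-- Every path reduces to a linear combination of smaller parallel elements of `B`. -/
theorem pathClass_mem_span_homLe (hB : IsPBWBasis I.toIdeal o B)
    (hI : ∀ p : QuiverPath V, p.length ≤ 1 → p ∈ B) (p : QuiverPath V) :
    pathClass I.toIdeal p ∈ Submodule.span F (pathClass I.toIdeal ''
      {r | r ∈ B ∧ r.source = p.source ∧ r.target = p.target ∧ HomLe o r p}) := by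
  induction hn : p.length generalizing p with
  | zero => exact Submodule.subset_span ⟨p, ⟨hI p (by omega), rfl, rfl, Or.inl rfl⟩, rfl⟩
  | succ n ih =>
    obtain ⟨q, a, h, ha, rfl⟩ := exists_cat_of_le' (p := p) (k := 1) (by omega)
    have hq := ih q (by have := length_cat h; omega)
    rw [← pathClass_mul _ h]
    -- The prefix `q` is already reduced to elements `r` of `B`, and the product condition reduces
    -- each `ra` in a single further step.
    have h1 := Submodule.mem_map_of_mem
      (f := LinearMap.mulRight F (pathClass I.toIdeal a)) hq
    rw [Submodule.map_span] at h1
    refine Submodule.span_le.2 ?_ h1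
    rintro _ ⟨_, ⟨r, ⟨hr, hs, ht, hle⟩, rfl⟩, rfl⟩
    have h' : r.target = a.source := ht.trans h
    rw [LinearMap.mulRight_apply, pathClass_mul _ h']
    have hle' : HomLe o (r ⋆ a) (q ⋆ a) := hle.cat_right h' h
    rcases hB.mul_mem_or r hr a (hI a ha.le) h' with h2 | h2
    · rw [← cat_eq_comp] at h2
      exact Submodule.subset_span ⟨_, ⟨h2, by simpa using hs,
        by rw [target_cat h, target_cat h'], hle'⟩, rfl⟩
    · rw [← cat_eq_comp] at h2
      -- The product condition alone allows shorter or non-parallel terms. The grading and the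
      -- idempotents at the vertices discard them.
      refine Submodule.span_mono (Set.image_mono ?_) (pathClass_mem_span_parallel h2)
      rintro s ⟨⟨hs1, hs2⟩, hs3, hs4, hs5⟩
      refine ⟨hs1, by simpa [hs3] using hs, by rw [hs4, target_cat h, target_cat h'], ?_⟩
      exact HomLe.trans (Or.inr ⟨hs5, hs2⟩) hle'

end IsPBWBasis

/-! ### Spans of the elements `w[c]`, filtered by the label `wc` -/

section ChainModule

variable {F V : Type*} [Field F] [Quiver V]

/-- Sets of paths closed under passing to smaller paths of the same length. -/
def IsHomLower (o : LinearOrder (Quiver.Total V)) (S : Set (QuiverPath V)) : Prop :=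
  ∀ p ∈ S, ∀ q, HomLt o q p → q ∈ S

theorem isHomLower_homLt (o : LinearOrder (Quiver.Total V)) (p : QuiverPath V) :
    IsHomLower o {q | HomLt o q p} := fun _ hq _ hr => hr.trans hq

theorem IsHomLower.inter_lt {o : LinearOrder (Quiver.Total V)} {S : Set (QuiverPath V)}
    (hS : IsHomLower o S) (p : QuiverPath V) : IsHomLower o (S ∩ {q | Lt o q p}) :=
  fun q hq r hr => ⟨hS q hq.1 r hr, hr.2.trans hq.2⟩

/-- The pairs `(c, w)` of a chain `c` of length `i` and an element `w` of `B` such that the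
path `wc` is in `S`. -/
def chainIndex (B : Set (QuiverPath V)) (i : ℕ) (S : Set (QuiverPath V)) :
    Set (QuiverPath V × QuiverPath V) :=
  {x | x.2 ∈ B ∧ IsChain B x.1 ∧ x.1.length = i ∧ x.2.target = x.1.source ∧ x.2 ⋆ x.1 ∈ S}

variable [Fintype V] (I : HomogeneousIdeal (PathAlgebra.grading F V)) [I.toIdeal.IsTwoSided]

/-- The free module over `F Q / I` on the set of all paths. -/
abbrev FreePathModule : Type _ := QuiverPath V →₀ QuotientAlgebra I.toIdeal

/-- The span of the elements `w[c]`, for chains `c` of length `i` and `w ∈ B`, such that the path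
`wc` is in `S`. -/
def chainSpan (B : Set (QuiverPath V)) (i : ℕ) (S : Set (QuiverPath V)) :
    Submodule F (FreePathModule I) :=
  Submodule.span F ((fun x : QuiverPath V × QuiverPath V =>
    (Finsupp.single x.1 (pathClass I.toIdeal x.2) : FreePathModule I)) '' chainIndex B i S)

variable {I} {o : LinearOrder (Quiver.Total V)} {B : Set (QuiverPath V)}

theorem chainSpan_mono {i : ℕ} {S T : Set (QuiverPath V)} (h : S ⊆ T) :
    chainSpan I B i S ≤ chainSpan I B i T :=
  Submodule.span_mono (Set.image_mono fun _ hx =>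
    ⟨hx.1, hx.2.1, hx.2.2.1, hx.2.2.2.1, h hx.2.2.2.2⟩)

theorem single_mem_chainSpan {i : ℕ} {S : Set (QuiverPath V)} {c w : QuiverPath V} (hw : w ∈ B)
    (hc : IsChain B c) (hi : c.length = i) (h : w.target = c.source) (hS : w ⋆ c ∈ S) :
    Finsupp.single c (pathClass I.toIdeal w) ∈ chainSpan I B i S :=
  Submodule.subset_span ⟨(c, w), ⟨hw, hc, hi, h, hS⟩, rfl⟩

theorem chainSpan_le {i : ℕ} {S : Set (QuiverPath V)} {p : Submodule F (FreePathModule I)}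
    (h : ∀ c w, w ∈ B → IsChain B c → c.length = i → w.target = c.source → w ⋆ c ∈ S →
      Finsupp.single c (pathClass I.toIdeal w) ∈ p) : chainSpan I B i S ≤ p := by
  refine Submodule.span_le.2 ?_
  rintro _ ⟨⟨c, w⟩, ⟨h1, h2, h3, h4, h5⟩, rfl⟩
  exact h c w h1 h2 h3 h4 h5

theorem map_mem_of_mem_chainSpan {M : Type*} [AddCommGroup M] [Module F M]
    (f : FreePathModule I →ₗ[F] M) {i : ℕ} {S : Set (QuiverPath V)} {p : Submodule F M}
    (h : ∀ c w, w ∈ B → IsChain B c → c.length = i → w.target = c.source → w ⋆ c ∈ S →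
      f (Finsupp.single c (pathClass I.toIdeal w)) ∈ p) {x : FreePathModule I}
    (hx : x ∈ chainSpan I B i S) : f x ∈ p :=
  chainSpan_le (p := p.comap f) h hx

theorem smul_single_pathClass_mem_span {X T : Set (QuiverPath V)} {c w : QuiverPath V}
    (hw : pathClass I.toIdeal w ∈ Submodule.span F (pathClass I.toIdeal '' X)) {i : ℕ}
    (h : ∀ r ∈ X, Finsupp.single c (pathClass I.toIdeal r) ∈ chainSpan I B i T) :
    Finsupp.single c (pathClass I.toIdeal w) ∈ chainSpan I B i T := by
  have h1 := Submodule.mem_map_of_mem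
    (f := (Finsupp.lsingle c : QuotientAlgebra I.toIdeal →ₗ[F] FreePathModule I)) hw
  rw [Submodule.map_span] at h1
  refine Submodule.span_le.2 ?_ h1
  rintro _ ⟨_, ⟨r, hr, rfl⟩, rfl⟩
  exact h r hr

/-- Here `w` need not be in `B`. Reducing it only lowers the label within its length, which `S`
tolerates. -/
theorem IsPBWBasis.single_mem_chainSpan (hB : IsPBWBasis I.toIdeal o B)
    (hI : ∀ p : QuiverPath V, p.length ≤ 1 → p ∈ B) {i : ℕ} {S : Set (QuiverPath V)}
    (hS : IsHomLower o S) {c w : QuiverPath V}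
    (hc : IsChain B c) (hi : c.length = i) (h : w.target = c.source) (hwc : w ⋆ c ∈ S) :
    Finsupp.single c (pathClass I.toIdeal w) ∈ chainSpan I B i S := by
  refine smul_single_pathClass_mem_span (hB.pathClass_mem_span_homLe hI w) ?_
  rintro r ⟨hr, -, ht, hle⟩
  refine _root_.single_mem_chainSpan hr hc hi (ht.trans h) ?_
  rcases hle with rfl | hlt
  · exact hwc
  · exact hS _ hwc _ (hlt.cat_right (ht.trans h) h)

/-- When `w ∉ B`, it cannot occur in its own reduction, so every label drops strictly. -/
theorem IsPBWBasis.single_mem_chainSpan_of_notMem (hB : IsPBWBasis I.toIdeal o B)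
    (hI : ∀ p : QuiverPath V, p.length ≤ 1 → p ∈ B) {i : ℕ} {c w : QuiverPath V}
    (hc : IsChain B c) (hi : c.length = i) (h : w.target = c.source) (hw : w ∉ B) :
    Finsupp.single c (pathClass I.toIdeal w) ∈ chainSpan I B i {r | HomLt o r (w ⋆ c)} := by
  refine smul_single_pathClass_mem_span (hB.pathClass_mem_span_homLe hI w) ?_
  rintro r ⟨hr, -, ht, hle⟩
  refine _root_.single_mem_chainSpan hr hc hi (ht.trans h) ?_
  rcases hle with rfl | hlt
  · exact absurd hr hw
  · exact hlt.cat_right (ht.trans h) h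

theorem IsPBWBasis.smul_mem_chainSpan (hB : IsPBWBasis I.toIdeal o B)
    (hI : ∀ p : QuiverPath V, p.length ≤ 1 → p ∈ B) {i : ℕ} {S T : Set (QuiverPath V)}
    (hT : IsHomLower o T) {u : QuiverPath V} (hu : ∀ r ∈ S, u.target = r.source → u ⋆ r ∈ T)
    {x : FreePathModule I} (hx : x ∈ chainSpan I B i S) :
    pathClass I.toIdeal u • x ∈ chainSpan I B i T := by
  refine map_mem_of_mem_chainSpan
    (Algebra.lsmul F F (FreePathModule I) (pathClass I.toIdeal u)) (fun c w _ hc hi h hS => ?_) hx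
  change pathClass I.toIdeal u • (Finsupp.single c (pathClass I.toIdeal w) : FreePathModule I) ∈ _
  rw [Finsupp.smul_single, smul_eq_mul]
  by_cases hw : u.target = w.source
  · have h1 := cat_assoc hw h
    rw [pathClass_mul _ hw]
    exact hB.single_mem_chainSpan hI hT hc hi ((target_cat hw).trans h)
      (h1 ▸ hu _ hS (hw.trans (source_cat w c).symm))
  · rw [pathClass_mul_of_ne _ hw, Finsupp.single_zero]
    exact zero_mem _

/-- The elements `w[c]` with `w ∈ B` are linearly independent over the field, so one whose label
lies outside `T` cannot occur in the span for `T`. -/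
theorem IsPBWBasis.eq_zero_of_smul_single_mem (hB : IsPBWBasis I.toIdeal o B) {i : ℕ}
    {T : Set (QuiverPath V)} {c w : QuiverPath V} (hw : w ∈ B) (hT : w ⋆ c ∉ T) {a : F}
    (h : a • (Finsupp.single c (pathClass I.toIdeal w) : FreePathModule I) ∈ chainSpan I B i T) :
    a = 0 := by
  by_contra ha
  have h1 := (Submodule.smul_mem_iff _ ha).1 h
  have hli : LinearIndependent F fun x : Σ _ : QuiverPath V, B =>
      (Finsupp.single x.1 (pathClass I.toIdeal x.2) : FreePathModule I) :=
    Finsupp.linearIndependent_single (fun _ (p : B) => pathClass I.toIdeal (p : QuiverPath V))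
      fun _ => hB.linearIndependent
  refine hli.notMem_span_image (s := {x | (x.1, (x.2 : QuiverPath V)) ∈ chainIndex B i T})
    (x := ⟨c, w, hw⟩) (fun h2 => hT h2.2.2.2.2) ?_
  refine Submodule.span_mono ?_ h1
  rintro _ ⟨⟨c, w⟩, hx, rfl⟩
  exact ⟨⟨c, w, hx.1⟩, hx, rfl⟩

/-- A label `p` can be cut in only one way as `wc` with `c` of length `i`, so at most one basis
element carries it. This isolates the leading term. -/
theorem mem_chainSpan_inter_le {i : ℕ} {S : Set (QuiverPath V)} {p : QuiverPath V}
    {y : FreePathModule I} (hy : y ∈ chainSpan I B i (S ∩ {q | q = p ∨ Lt o q p})) :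
    y ∈ chainSpan I B i (S ∩ {q | Lt o q p}) ∨
      ∃ c w, w ∈ B ∧ IsChain B c ∧ c.length = i ∧ w.target = c.source ∧ w ⋆ c = p ∧ p ∈ S ∧
        ∃ a : F, ∃ y' ∈ chainSpan I B i (S ∩ {q | Lt o q p}),
          y = a • Finsupp.single c (pathClass I.toIdeal w) + y' := by
  by_cases H : p ∈ S ∧ ∃ c w, w ∈ B ∧ IsChain B c ∧ c.length = i ∧ w.target = c.source ∧ w ⋆ c = p
  · obtain ⟨hp, c, w, hw, hc, hi, h, hwc⟩ := H
    refine Or.inr ⟨c, w, hw, hc, hi, h, hwc, hp, ?_⟩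
    refine Submodule.mem_span_insert.1 (Submodule.span_mono ?_ hy)
    rintro _ ⟨⟨c', w'⟩, ⟨h1, h2, h3, h4, h5, h6 | h6⟩, rfl⟩
    · obtain ⟨rfl, rfl⟩ := cat_inj' h4 h (h6.trans hwc.symm) (h3.trans hi.symm)
      exact Or.inl rfl
    · exact Or.inr ⟨(c', w'), ⟨h1, h2, h3, h4, h5, h6⟩, rfl⟩
  · refine Or.inl (chainSpan_le (fun c w h1 h2 h3 h4 h5 => ?_) hy)
    rcases h5 with ⟨h5, h6 | h6⟩
    · exact absurd ⟨h6 ▸ h5, c, w, h1, h2, h3, h4, h6⟩ H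
    · exact single_mem_chainSpan h1 h2 h3 h4 ⟨h5, h6⟩

/-- A finite combination has a largest label. Chains of length `i + 1` give labels of positive
length, where the order is total. -/
theorem exists_mem_chainSpan_inter_le {i : ℕ} {S : Set (QuiverPath V)}
    {y : FreePathModule I} (hy : y ∈ chainSpan I B (i + 1) S) :
    y = 0 ∨ ∃ p ∈ S, 0 < p.length ∧
      y ∈ chainSpan I B (i + 1) (S ∩ {q | q = p ∨ Lt o q p}) := by
  induction hy using Submodule.span_induction with
  | zero => exact Or.inl rfl
  | mem x hx =>
    obtain ⟨⟨c, w⟩, ⟨h1, h2, h3, h4, h5⟩, rfl⟩ := hx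
    exact Or.inr ⟨w ⋆ c, h5, by rw [length_cat h4, h3]; omega,
      single_mem_chainSpan h1 h2 h3 h4 ⟨h5, Or.inl rfl⟩⟩
  | smul a x _ hx =>
    rcases hx with rfl | ⟨p, hp, h0, hx⟩
    · exact Or.inl (smul_zero a)
    · exact Or.inr ⟨p, hp, h0, Submodule.smul_mem _ a hx⟩
  | add x y _ _ hx hy =>
    rcases hx with rfl | ⟨p, hp, h0, hx⟩
    · rwa [zero_add]
    rcases hy with rfl | ⟨q, hq, h0', hy⟩
    · rw [add_zero]
      exact Or.inr ⟨p, hp, h0, hx⟩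
    have key : ∀ {p q : QuiverPath V}, (p = q ∨ Lt o p q) →
        chainSpan I B (i + 1) (S ∩ {r | r = p ∨ Lt o r p}) ≤
          chainSpan I B (i + 1) (S ∩ {r | r = q ∨ Lt o r q}) := by
      rintro p q (rfl | h)
      · exact le_rfl
      · refine chainSpan_mono (Set.inter_subset_inter_right S ?_)
        rintro r (rfl | h')
        · exact Or.inr h
        · exact Or.inr (h'.trans h)
    rcases Lt.trichotomous (o := o) p q h0 with h | h | h
    · exact Or.inr ⟨q, hq, h0', add_mem (key (Or.inr h) hx) hy⟩
    · exact Or.inr ⟨q, hq, h0', add_mem (key (Or.inl h) hx) hy⟩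
    · exact Or.inr ⟨p, hp, h0, add_mem hx (key (Or.inr h) hy)⟩

end ChainModule

/-! ### Leading terms, exactness and the inductive step -/

section Stage

variable {F V : Type*} [Field F] [Quiver V] [Fintype V]
  {I : HomogeneousIdeal (PathAlgebra.grading F V)} [I.toIdeal.IsTwoSided]
  {o : LinearOrder (Quiver.Total V)} {B : Set (QuiverPath V)}

/-- The differential `d` sends the generator `[ac]`, for an arrow `a`, to `a[c]` up to smaller
terms. -/
def HasLeadingTerm (o : LinearOrder (Quiver.Total V)) (B : Set (QuiverPath V)) (i : ℕ)
    (d : FreePathModule I →ₗ[QuotientAlgebra I.toIdeal] FreePathModule I) : Prop :=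
  ∀ a c, a.length = 1 → c.length = i → a.target = c.source → IsChain B (a ⋆ c) →
    d (Finsupp.single (a ⋆ c) 1) - Finsupp.single c (pathClass I.toIdeal a) ∈
      chainSpan I B i {r | HomLt o r (a ⋆ c)}

/-- One step of the resolution: the map `d`, from level `i + 1` to level `i`, has image in `N`, and
is onto `N` compatibly with the order on paths. -/
structure IsResolutionStep (o : LinearOrder (Quiver.Total V)) (B : Set (QuiverPath V)) (i : ℕ)
    (N : Set (FreePathModule I))
    (d : FreePathModule I →ₗ[QuotientAlgebra I.toIdeal] FreePathModule I) : Prop where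
  map_mem : ∀ x, d x ∈ N
  leading : HasLeadingTerm o B i d
  exact : ∀ S, IsHomLower o S → ∀ y ∈ N, y ∈ chainSpan I B i S →
    ∃ x ∈ chainSpan I B (i + 1) S, d x = y

namespace HasLeadingTerm

variable {i : ℕ} {d : FreePathModule I →ₗ[QuotientAlgebra I.toIdeal] FreePathModule I}

theorem map_single (hd : HasLeadingTerm o B i d) (hB : IsPBWBasis I.toIdeal o B)
    (hI : ∀ p : QuiverPath V, p.length ≤ 1 → p ∈ B) {a c w : QuiverPath V}
    (ha : a.length = 1) (hc : c.length = i) (h : a.target = c.source) (hac : IsChain B (a ⋆ c))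
    (hw : w.target = a.source) :
    d (Finsupp.single (a ⋆ c) (pathClass I.toIdeal w)) -
        Finsupp.single c (pathClass I.toIdeal (w ⋆ a)) ∈
      chainSpan I B i {r | HomLt o r (w ⋆ (a ⋆ c))} := by
  have h1 : (Finsupp.single (a ⋆ c) (pathClass I.toIdeal w) : FreePathModule I) =
      pathClass I.toIdeal w • Finsupp.single (a ⋆ c) 1 := by simp
  have h2 : (Finsupp.single c (pathClass I.toIdeal (w ⋆ a)) : FreePathModule I) =
      pathClass I.toIdeal w • Finsupp.single c (pathClass I.toIdeal a) := by
    rw [Finsupp.smul_single, smul_eq_mul, pathClass_mul _ hw]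
  rw [h1, h2, map_smul, ← smul_sub]
  exact hB.smul_mem_chainSpan hI (isHomLower_homLt o _)
    (fun r hr hwr => hr.cat_left hwr (hw.trans (source_cat _ _).symm)) (hd a c ha hc h hac)

/-- The expected leading term `wa[c]` is itself reducible, so the whole image lies strictly below
the label `wac`. -/
theorem map_single_of_notMem (hd : HasLeadingTerm o B i d) (hB : IsPBWBasis I.toIdeal o B)
    (hI : ∀ p : QuiverPath V, p.length ≤ 1 → p ∈ B) {a c w : QuiverPath V}
    (ha : a.length = 1) (hc : c.length = i) (h : a.target = c.source) (hac : IsChain B (a ⋆ c))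
    (hw : w.target = a.source) (hwa : w ⋆ a ∉ B) :
    d (Finsupp.single (a ⋆ c) (pathClass I.toIdeal w)) ∈
      chainSpan I B i {r | HomLt o r (w ⋆ (a ⋆ c))} := by
  rw [← sub_add_cancel (d _) (Finsupp.single c (pathClass I.toIdeal (w ⋆ a)))]
  refine add_mem (hd.map_single hB hI ha hc h hac hw) ?_
  rw [← cat_assoc hw h]
  exact hB.single_mem_chainSpan_of_notMem hI (hac.of_cat h) hc ((target_cat hw).trans h) hwa

theorem map_mem_chainSpan (hd : HasLeadingTerm o B i d) (hB : IsPBWBasis I.toIdeal o B)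
    (hI : ∀ p : QuiverPath V, p.length ≤ 1 → p ∈ B) {S : Set (QuiverPath V)}
    (hS : IsHomLower o S) {x : FreePathModule I} (hx : x ∈ chainSpan I B (i + 1) S) :
    d x ∈ chainSpan I B i S := by
  refine map_mem_of_mem_chainSpan (d.restrictScalars F) (fun c w _ hc hi h hwc => ?_) hx
  obtain ⟨a, c, hac, ha, rfl⟩ := exists_cat_of_le (p := c) (k := 1) (by omega)
  rw [length_cat hac] at hi
  rw [source_cat] at h
  rw [LinearMap.restrictScalars_apply,
    ← sub_add_cancel (d _) (Finsupp.single c (pathClass I.toIdeal (w ⋆ a)))]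
  refine add_mem (chainSpan_mono (fun r hr => hS _ hwc r hr)
    (hd.map_single hB hI ha (by omega) hac hc h)) ?_
  refine hB.single_mem_chainSpan hI hS (hc.of_cat hac) (by omega) ((target_cat h).trans hac) ?_
  rwa [cat_assoc h hac]

end HasLeadingTerm

/-- A step of the resolution which is a complex and has the right leading terms is exact. -/
theorem exists_preimage_of_leading (hB : IsPBWBasis I.toIdeal o B)
    (hI : ∀ p : QuiverPath V, p.length ≤ 1 → p ∈ B) [Finite (Quiver.Total V)] {i : ℕ}
    {d d' : FreePathModule I →ₗ[QuotientAlgebra I.toIdeal] FreePathModule I}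
    (hd : HasLeadingTerm o B i d) (hd' : HasLeadingTerm o B (i + 1) d')
    (hdd : ∀ x, d (d' x) = 0) {S : Set (QuiverPath V)} (hS : IsHomLower o S)
    {y : FreePathModule I} (hy : y ∈ chainSpan I B (i + 1) S) (hdy : d y = 0) :
    ∃ x ∈ chainSpan I B (i + 2) S, d' x = y := by
  -- Well-founded induction on an upper bound `p` for the labels. The set `S` varies because the
  -- inductive step passes to its part below `p`.
  have claim : ∀ (p : QuiverPath V) (S : Set (QuiverPath V)), IsHomLower o S →
      ∀ y ∈ chainSpan I B (i + 1) (S ∩ {q | q = p ∨ Lt o q p}), d y = 0 →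
      ∃ x ∈ chainSpan I B (i + 2) (S ∩ {q | q = p ∨ Lt o q p}), d' x = y := by
    intro p
    induction p using (Lt.wf (o := o)).induction with
    | _ p ih =>
    intro S hS y hy hdy
    have hle : S ∩ {q | Lt o q p} ⊆ S ∩ {q | q = p ∨ Lt o q p} := fun q hq => ⟨hq.1, Or.inr hq.2⟩
    have low : ∀ y ∈ chainSpan I B (i + 1) (S ∩ {q | Lt o q p}), d y = 0 →
        ∃ x ∈ chainSpan I B (i + 2) (S ∩ {q | Lt o q p}), d' x = y := by
      intro y hy hdy
      rcases exists_mem_chainSpan_inter_le (o := o) hy with rfl | ⟨q, hq, -, hy⟩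
      · exact ⟨0, zero_mem _, map_zero _⟩
      · obtain ⟨x, hx, rfl⟩ := ih q hq.2 _ (hS.inter_lt p) y hy hdy
        exact ⟨x, chainSpan_mono Set.inter_subset_left hx, rfl⟩
    rcases mem_chainSpan_inter_le hy with
      hy | ⟨c, w, hw, hc, hi, h, rfl, hp, a, y', hy', rfl⟩
    · obtain ⟨x, hx, rfl⟩ := low y hy hdy
      exact ⟨x, chainSpan_mono hle hx, rfl⟩
    obtain ⟨α, c, hαc, hα, rfl⟩ := exists_cat_of_le (p := c) (k := 1) (by omega)
    rw [length_cat hαc] at hi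
    rw [source_cat] at h
    have hci : c.length = i := by omega
    by_cases hwα : w ⋆ α ∈ B
    · have ha : a = 0 := by
        refine hB.eq_zero_of_smul_single_mem (i := i) (c := c) hwα
          (T := {q | Lt o q (w ⋆ (α ⋆ c))}) ?_ ?_
        · rw [cat_assoc h hαc]
          exact Lt.irrefl _
        · have h1 := chainSpan_mono (T := {q | Lt o q (w ⋆ (α ⋆ c))}) (fun r hr => hr.2)
            (hd.map_single hB hI hα hci hαc hc h)
          have h2 := chainSpan_mono (T := {q | Lt o q (w ⋆ (α ⋆ c))}) (fun r hr => hr.2)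
            (hd.map_mem_chainSpan hB hI (hS.inter_lt _) hy')
          have h3 := neg_mem (add_mem (Submodule.smul_mem _ a h1) h2)
          rw [map_add, LinearMap.map_smul_of_tower] at hdy
          convert h3 using 1
          rw [smul_sub, sub_add_eq_add_sub, hdy, zero_sub, neg_neg]
      subst ha
      rw [zero_smul, zero_add] at hdy ⊢
      obtain ⟨x, hx, rfl⟩ := low y' hy' hdy
      exact ⟨x, chainSpan_mono hle hx, rfl⟩
    -- If `w` were trivial, `wα` would have length one and hence lie in `B`.
    · have hw0 : 1 ≤ w.length := by
        by_contra h0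
        refine hwα (hI _ ?_)
        rw [length_cat h]
        omega
      obtain ⟨w, β, hwβ, hβ, rfl⟩ := exists_cat_of_le' hw0
      rw [target_cat hwβ] at h
      have hβα : β ⋆ α ∉ B := fun h1 =>
        hwα (by rw [cat_assoc hwβ h]; exact hB.cat_cat_mem hI hα hβ h h1 hwβ hw)
      have hch : IsChain B (β ⋆ (α ⋆ c)) := hc.cat h hαc hα hβ hβα
      have hs : β.target = (α ⋆ c).source := h.trans (source_cat _ _).symm
      have hwB : w ∈ B := (hB.mem_of_cat_mem hI hwβ hw).1
      have hl : (α ⋆ c).length = i + 1 := by rw [length_cat hαc]; omega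
      have e : w ⋆ β ⋆ (α ⋆ c) = w ⋆ (β ⋆ (α ⋆ c)) := cat_assoc hwβ hs
      have h1 := hd'.map_single hB hI hβ hl hs hch hwβ
      rw [← e] at h1
      have hx0 : (Finsupp.single (β ⋆ (α ⋆ c)) (pathClass I.toIdeal w) : FreePathModule I) ∈
          chainSpan I B (i + 2) (S ∩ {q | q = w ⋆ β ⋆ (α ⋆ c) ∨ Lt o q (w ⋆ β ⋆ (α ⋆ c))}) :=
        single_mem_chainSpan hwB hch (by rw [length_cat hs]; omega)
          (hwβ.trans (source_cat _ _).symm) ⟨e ▸ hp, Or.inl e.symm⟩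
      -- This is `y` minus `a` times the boundary of `w[βαc]`, written so that the leading terms
      -- have already cancelled. The remainder is a cycle with smaller labels.
      have h2 : y' - a • (d' (Finsupp.single (β ⋆ (α ⋆ c)) (pathClass I.toIdeal w)) -
          Finsupp.single (α ⋆ c) (pathClass I.toIdeal (w ⋆ β))) ∈
          chainSpan I B (i + 1) (S ∩ {q | Lt o q (w ⋆ β ⋆ (α ⋆ c))}) :=
        sub_mem hy' (Submodule.smul_mem _ a
          (chainSpan_mono (T := S ∩ {q | Lt o q (w ⋆ β ⋆ (α ⋆ c))})
            (fun r hr => ⟨hS _ hp r hr, hr.2⟩) h1))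
      obtain ⟨x, hx, hxy⟩ := low _ h2 (by
        rw [map_sub, LinearMap.map_smul_of_tower, map_sub, hdd, zero_sub, smul_neg,
          sub_neg_eq_add, add_comm, ← LinearMap.map_smul_of_tower, ← map_add, hdy])
      refine ⟨x + a • Finsupp.single (β ⋆ (α ⋆ c)) (pathClass I.toIdeal w),
        add_mem (chainSpan_mono hle hx) (Submodule.smul_mem _ a hx0), ?_⟩
      rw [map_add, hxy, LinearMap.map_smul_of_tower, smul_sub]
      abel
  rcases exists_mem_chainSpan_inter_le (o := o) hy with rfl | ⟨p, hp, -, hy⟩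
  · exact ⟨0, zero_mem _, map_zero _⟩
  · obtain ⟨x, hx, rfl⟩ := claim p S hS y hy hdy
    exact ⟨x, chainSpan_mono Set.inter_subset_left hx, rfl⟩

/-- A step of the resolution can be continued by a further step. -/
theorem IsResolutionStep.exists_next (hB : IsPBWBasis I.toIdeal o B)
    (hI : ∀ p : QuiverPath V, p.length ≤ 1 → p ∈ B) [Finite (Quiver.Total V)] {i : ℕ}
    {N : Set (FreePathModule I)}
    {d : FreePathModule I →ₗ[QuotientAlgebra I.toIdeal] FreePathModule I}
    (hd : IsResolutionStep o B i N d) :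
    ∃ d' : FreePathModule I →ₗ[QuotientAlgebra I.toIdeal] FreePathModule I,
      IsResolutionStep o B (i + 1) {x | d x = 0} d' := by
  have key : ∀ e : QuiverPath V, ∃ z : FreePathModule I, d z = 0 ∧
      ∀ b c, b.length = 1 → c.length = i + 1 → b.target = c.source → IsChain B (b ⋆ c) →
        b ⋆ c = e → z - Finsupp.single c (pathClass I.toIdeal b) ∈
          chainSpan I B (i + 1) {r | HomLt o r (b ⋆ c)} := by
    intro e
    by_cases H : ∃ b c, b.length = 1 ∧ c.length = i + 1 ∧ b.target = c.source ∧
      IsChain B (b ⋆ c) ∧ b ⋆ c = e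
    · obtain ⟨b, c, hb, hc, h, hch, rfl⟩ := H
      obtain ⟨a, c, hac, ha, rfl⟩ := exists_cat_of_le (p := c) (k := 1) (by omega)
      have hci : c.length = i := by rw [length_cat hac] at hc; omega
      have h' : b.target = a.source := h.trans (source_cat _ _)
      -- As `ba ∉ B`, the image of `b[ac]` has labels strictly below `bac`. It thus has a second
      -- preimage `x` below `bac`, and the difference of the two is the desired cycle.
      obtain ⟨x, hx, hxy⟩ := hd.exact _ (isHomLower_homLt o _) _ (hd.map_mem _)
        (hd.leading.map_single_of_notMem hB hI ha hci hac (hch.of_cat h) h'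
          (hch.notMem h' hac ha hb))
      refine ⟨Finsupp.single (a ⋆ c) (pathClass I.toIdeal b) - x, ?_, ?_⟩
      · rw [map_sub, hxy, sub_self]
      · intro b' c' hb' hc' h1 _ e
        obtain ⟨rfl, rfl⟩ := cat_inj h1 h e (hb'.trans hb.symm)
        rw [sub_sub_cancel_left]
        exact neg_mem hx
    -- Other basis paths are sent to zero, so the composite vanishes on the whole free module.
    · exact ⟨0, map_zero d, fun b c h1 h2 h3 h4 h5 => absurd ⟨b, c, h1, h2, h3, h4, h5⟩ H⟩
  choose z hz hz' using key
  let d' : FreePathModule I →ₗ[QuotientAlgebra I.toIdeal] FreePathModule I :=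
    Finsupp.linearCombination (QuotientAlgebra I.toIdeal) z
  have hdd : ∀ x, d (d' x) = 0 := by
    intro x
    induction x using Finsupp.induction_linear with
    | zero => simp
    | add x y hx hy => rw [map_add, map_add, hx, hy, add_zero]
    | single c a => simp [d', hz]
  have hlead : HasLeadingTerm o B (i + 1) d' := by
    intro b c hb hc h hch
    have := hz' _ b c hb hc h hch rfl
    simpa [d'] using this
  exact ⟨d', hdd, hlead, fun S hS y hy hyS =>
    exists_preimage_of_leading hB hI hd.leading hlead hdd hS hyS hy⟩

end Stage

/-! ### The augmentation and the first differential -/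

section Base

variable {F V : Type*} [Field F] [Quiver V] [Fintype V]
  (I : HomogeneousIdeal (PathAlgebra.grading F V)) [I.toIdeal.IsTwoSided]
  {o : LinearOrder (Quiver.Total V)} {B : Set (QuiverPath V)}

/-- The sum of the coefficients of an element of the free module on all paths. -/
def coeffSum : FreePathModule I →ₗ[QuotientAlgebra I.toIdeal] QuotientAlgebra I.toIdeal :=
  Finsupp.linearCombination _ fun _ => 1

theorem coeffSum_single (c : QuiverPath V) (a : QuotientAlgebra I.toIdeal) :
    coeffSum I (Finsupp.single c a) = a := by
  simp [coeffSum]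

/-- The map `a ↦ ∑ v, a e_v [v]`. -/
def spread : QuotientAlgebra I.toIdeal →ₗ[F] FreePathModule I :=
  ∑ v : V, (Finsupp.lsingle (vertex v)) ∘ₗ
    LinearMap.mulRight F (pathClass I.toIdeal (vertex v))

theorem spread_apply (a : QuotientAlgebra I.toIdeal) :
    spread I a = ∑ v : V, Finsupp.single (vertex v) (a * pathClass I.toIdeal (vertex v)) := by
  simp [spread, LinearMap.sum_apply]

theorem spread_pathClass (w : QuiverPath V) :
    spread I (pathClass I.toIdeal w) =
      Finsupp.single (vertex w.target) (pathClass I.toIdeal w) := by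
  rw [spread_apply, Finset.sum_eq_single w.target]
  · rw [pathClass_mul_vertex]
  · intro v _ hv
    rw [pathClass_mul_of_ne _ (by simpa using hv.symm), Finsupp.single_zero]
  · simp

theorem coeffSum_spread (a : QuotientAlgebra I.toIdeal) : coeffSum I (spread I a) = a := by
  rw [spread_apply, map_sum]
  simp only [coeffSum_single]
  rw [← Finset.mul_sum, ← one_eq_sum_pathClass, mul_one]

/-- The composite of the sum of the coefficients and of the projection to degree zero. -/
def augmentation : FreePathModule I →ₛₗ[GradedRing.projZeroRingHom'
    (quotientGrading (PathAlgebra.grading F V) I)]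
    quotientGrading (PathAlgebra.grading F V) I 0 where
  toFun x := GradedRing.projZeroRingHom' _ (coeffSum I x)
  map_add' x y := by rw [map_add, map_add]
  map_smul' a x := by rw [map_smul, smul_eq_mul, map_mul, smul_eq_mul]

theorem coe_augmentation (x : FreePathModule I) :
    (augmentation I x : QuotientAlgebra I.toIdeal) =
      GradedAlgebra.proj (quotientGrading (PathAlgebra.grading F V) I) 0 (coeffSum I x) := rfl

theorem augmentation_single_of_pos {c p : QuiverPath V} (hp : 0 < p.length)
    (a : QuotientAlgebra I.toIdeal) :
    augmentation I (Finsupp.single c (a * pathClass I.toIdeal p)) = 0 := by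
  have h : (Finsupp.single c (a * pathClass I.toIdeal p) : FreePathModule I) =
      a • Finsupp.single c (pathClass I.toIdeal p) := by simp
  rw [h, map_smulₛₗ]
  have h1 : augmentation I (Finsupp.single c (pathClass I.toIdeal p)) = 0 := by
    apply Subtype.ext
    rw [coe_augmentation, coeffSum_single, proj_pathClass_of_ne I hp.ne']
    rfl
  rw [h1, smul_zero]

open scoped Classical in
/-- The first differential `[a] ↦ a[v]`, where `v` is the target of the arrow `a`. -/
def firstDifferential :
    FreePathModule I →ₗ[QuotientAlgebra I.toIdeal] FreePathModule I :=
  Finsupp.linearCombination _ fun c =>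
    if c.length = 1 then Finsupp.single (vertex c.target) (pathClass I.toIdeal c) else 0

theorem firstDifferential_single {c : QuiverPath V} (hc : c.length = 1)
    (a : QuotientAlgebra I.toIdeal) :
    firstDifferential I (Finsupp.single c a) =
      Finsupp.single (vertex c.target) (a * pathClass I.toIdeal c) := by
  simp [firstDifferential, hc]

theorem firstDifferential_single_of_ne {c : QuiverPath V} (hc : c.length ≠ 1)
    (a : QuotientAlgebra I.toIdeal) :
    firstDifferential I (Finsupp.single c a) = 0 := by
  simp [firstDifferential, hc]

theorem isResolutionStep_firstDifferential (hB : IsPBWBasis I.toIdeal o B)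
    (hI : ∀ p : QuiverPath V, p.length ≤ 1 → p ∈ B) :
    IsResolutionStep o B 0 {x | augmentation I x = 0} (firstDifferential I) where
  map_mem x := by
    change augmentation I _ = 0
    induction x using Finsupp.induction_linear with
    | zero => simp
    | add x y hx hy => rw [map_add, map_add, hx, hy, add_zero]
    | single c a =>
      by_cases hc : c.length = 1
      · rw [firstDifferential_single I hc]
        exact augmentation_single_of_pos I (by omega) a
      · rw [firstDifferential_single_of_ne I hc, map_zero]
  leading a c ha hc h _ := by
    rw [eq_vertex_of_length_eq_zero hc, cat_vertex, firstDifferential_single I ha, one_mul, h,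
      sub_self]
    exact zero_mem _
  exact S hS y hy hyS := by
    -- On level zero `G` removes the terms `w[v]` with `w` trivial and fixes the others. It
    -- therefore fixes the kernel of the augmentation, while each surviving `ua[v]`, with `a` an
    -- arrow, is the image of `u[a]` with the same label.
    let G : FreePathModule I →ₗ[F] FreePathModule I :=
      spread I ∘ₗ (LinearMap.id -
        GradedAlgebra.proj (quotientGrading (PathAlgebra.grading F V) I) 0) ∘ₗ
        (coeffSum I).restrictScalars F
    have hG : ∀ c a, G (Finsupp.single c a) = spread I a - spread I
        (GradedAlgebra.proj (quotientGrading (PathAlgebra.grading F V) I) 0 a) := by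
      intro c a
      simp [G, coeffSum_single]
    have h1 : G y ∈ (chainSpan I B 1 S).map ((firstDifferential I).restrictScalars F) := by
      refine map_mem_of_mem_chainSpan G (fun c w hw hc hi h hwc => ?_) hyS
      rw [hG]
      rcases Nat.eq_zero_or_pos w.length with h0 | h0
      · rw [proj_pathClass_of_eq I h0, sub_self]
        exact zero_mem _
      · rw [proj_pathClass_of_ne I h0.ne', map_zero, sub_zero, spread_pathClass]
        obtain ⟨u, a, hua, ha, rfl⟩ := exists_cat_of_le' (p := w) (k := 1) h0
        rw [eq_vertex_of_length_eq_zero hi, cat_vertex] at hwc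
        refine ⟨Finsupp.single a (pathClass I.toIdeal u), single_mem_chainSpan
          (hB.mem_of_cat_mem hI hua hw).1 (IsChain.of_length_le_one ha.le) ha hua hwc, ?_⟩
        rw [LinearMap.restrictScalars_apply, firstDifferential_single I ha, pathClass_mul _ hua,
          target_cat hua]
    have h2 : G y = y := by
      have h3 : spread I (coeffSum I y) = y := by
        have : y ∈ LinearMap.ker (spread I ∘ₗ (coeffSum I).restrictScalars F - LinearMap.id) := by
          refine chainSpan_le (fun c w _ _ hi h _ => ?_) hyS
          rw [LinearMap.mem_ker]
          simp only [LinearMap.sub_apply, LinearMap.comp_apply, LinearMap.restrictScalars_apply,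
            LinearMap.id_apply, coeffSum_single, spread_pathClass]
          rw [h, ← eq_vertex_of_length_eq_zero hi, sub_self]
        exact sub_eq_zero.1 this
      have h4 : GradedAlgebra.proj (quotientGrading (PathAlgebra.grading F V) I) 0
          (coeffSum I y) = 0 := by
        rw [← coe_augmentation, show augmentation I y = 0 from hy]
        rfl
      simp [G, h3, h4]
    rw [h2] at h1
    exact h1

end Base

theorem isHomLower_univ {V : Type*} [Quiver V] (o : LinearOrder (Quiver.Total V)) : IsHomLower o Set.univ :=
  fun _ _ _ _ => trivial

theorem isHomLower_length {V : Type*} [Quiver V] (o : LinearOrder (Quiver.Total V)) (n : ℕ) :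
    IsHomLower o {p | p.length = n} := fun _ hp _ hq => hq.1.trans hp

/-- The projections may live on an ambient group `E`. They recover each component of a sum, so they
need not be restricted to `M`. -/
theorem injective_coeAddMonoidHom_of_projections {ι M E : Type*} [DecidableEq ι] [AddCommGroup M]
    [AddCommGroup E] (𝒢 : ι → AddSubgroup M) (j : M →+ E) (hj : Function.Injective j)
    (π : ι → E →+ E) (h : ∀ n, ∀ x ∈ 𝒢 n, π n (j x) = j x)
    (h' : ∀ m n, m ≠ n → ∀ x ∈ 𝒢 m, π n (j x) = 0) :
    Function.Injective (DirectSum.coeAddMonoidHom 𝒢) := by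
  have key : ∀ (n : ι) (x : ⨁ n, 𝒢 n), π n (j (DirectSum.coeAddMonoidHom 𝒢 x)) = j (x n) := by
    intro n x
    induction x using DirectSum.induction_on with
    | zero => simp
    | add x y hx hy => rw [map_add, map_add, map_add, hx, hy, DirectSum.add_apply,
        AddSubgroup.coe_add, map_add]
    | of m x =>
      rw [DirectSum.coeAddMonoidHom_of]
      by_cases hmn : m = n
      · subst hmn
        rw [h m _ x.2, DirectSum.of_eq_same]
      · rw [h' m n hmn _ x.2, DirectSum.of_eq_of_ne _ _ _ (Ne.symm hmn), AddSubgroup.coe_zero,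
          map_zero]
  rw [injective_iff_map_eq_zero]
  intro x hx
  refine DFinsupp.ext fun n => Subtype.ext (hj ?_)
  refine (key n x).symm.trans ?_
  rw [hx, map_zero, map_zero]
  exact (map_zero j).symm

/-! ### Assembling the linear resolution -/

section Resolution

variable {F V : Type*} [Field F] [Quiver V] [Fintype V]
  {I : HomogeneousIdeal (PathAlgebra.grading F V)} [I.toIdeal.IsTwoSided]
  {o : LinearOrder (Quiver.Total V)} {B : Set (QuiverPath V)}

theorem exists_differentials (hB : IsPBWBasis I.toIdeal o B)
    (hI : ∀ p : QuiverPath V, p.length ≤ 1 → p ∈ B) [Finite (Quiver.Total V)] :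
    ∃ d : ℕ → FreePathModule I →ₗ[QuotientAlgebra I.toIdeal] FreePathModule I,
      IsResolutionStep o B 0 {x | augmentation I x = 0} (d 0) ∧
      ∀ i, IsResolutionStep o B (i + 1) {x | d i x = 0} (d (i + 1)) := by
  -- The target set `N` is hidden in an existential because it changes at each stage. The recursion
  -- then needs only the map.
  let Step (i : ℕ) : Type _ :=
    {d : FreePathModule I →ₗ[QuotientAlgebra I.toIdeal] FreePathModule I //
      ∃ N, IsResolutionStep o B i N d}
  have next : ∀ i (d : Step i), ∃ d' : Step (i + 1),
      IsResolutionStep o B (i + 1) {x | d.1 x = 0} d'.1 := by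
    rintro i ⟨d, N, hd⟩
    obtain ⟨d', hd'⟩ := hd.exists_next hB hI
    exact ⟨⟨d', _, hd'⟩, hd'⟩
  choose f hf using next
  let s : ∀ i, Step i := fun i => Nat.rec
    ⟨firstDifferential I, _, isResolutionStep_firstDifferential I hB hI⟩ (fun i d => f i d) i
  exact ⟨fun i => (s i).1, isResolutionStep_firstDifferential I hB hI, fun i => hf i (s i)⟩

theorem IsPBWBasis.smul_mem_chainSpan_of_mem_span (hB : IsPBWBasis I.toIdeal o B)
    (hI : ∀ p : QuiverPath V, p.length ≤ 1 → p ∈ B) {i : ℕ} {S T X : Set (QuiverPath V)}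
    (hT : IsHomLower o T) (h : ∀ u ∈ X, ∀ r ∈ S, u.target = r.source → u ⋆ r ∈ T)
    {a : QuotientAlgebra I.toIdeal}
    (ha : a ∈ Submodule.span F (pathClass I.toIdeal '' X))
    {x : FreePathModule I} (hx : x ∈ chainSpan I B i S) : a • x ∈ chainSpan I B i T := by
  induction ha using Submodule.span_induction with
  | zero => rw [zero_smul]; exact zero_mem _
  | add a b _ _ ha hb => rw [add_smul]; exact add_mem ha hb
  | smul c a _ ha => rw [smul_assoc]; exact Submodule.smul_mem _ c ha
  | mem a ha =>
    obtain ⟨u, hu, rfl⟩ := ha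
    exact hB.smul_mem_chainSpan hI hT (h u hu) hx

/-- The terms of the resolution: the modules generated by the elements `e_v[c]`, for chains `c`
of length `i` that start at the vertex `v`. -/
def chainModule (hB : IsPBWBasis I.toIdeal o B)
    (hI : ∀ p : QuiverPath V, p.length ≤ 1 → p ∈ B) (i : ℕ) :
    Submodule (QuotientAlgebra I.toIdeal) (FreePathModule I) :=
  { (chainSpan I B i Set.univ).toAddSubmonoid with
    smul_mem' := fun a x hx => hB.smul_mem_chainSpan_of_mem_span hI (S := Set.univ)
      (X := Set.univ) (isHomLower_univ o) (fun _ _ _ _ _ => trivial)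
      (by rw [Set.image_univ, span_range_pathClass]; trivial) hx }

section Terms

variable (hB : IsPBWBasis I.toIdeal o B) (hI : ∀ p : QuiverPath V, p.length ≤ 1 → p ∈ B) (i : ℕ)

/-- The grading of `chainModule`, in which `w[c]` has the degree of the path `wc`. -/
def chainGrading (n : ℕ) : AddSubgroup (chainModule hB hI i) :=
  (chainSpan I B i {p | p.length = n}).toAddSubgroup.comap
    (chainModule hB hI i).subtype.toAddMonoidHom

/-- The projection of the free module on all paths which, on `chainModule`, is the projection
to the part of degree `n`. -/
def chainProj (I : HomogeneousIdeal (PathAlgebra.grading F V)) [I.toIdeal.IsTwoSided] (i n : ℕ) :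
    FreePathModule I →ₗ[F] FreePathModule I :=
  -- The coefficient of a chain of length `i` has degree `n - i`. Without the guard, truncated
  -- subtraction would select degree zero for `n < i`.
  if i ≤ n then Finsupp.mapRange.linearMap
    (GradedAlgebra.proj (quotientGrading (PathAlgebra.grading F V) I) (n - i)) else 0

theorem chainProj_of_mem {i n : ℕ} {x : FreePathModule I}
    (hx : x ∈ chainSpan I B i {p | p.length = n}) : chainProj I i n x = x := by
  have : x ∈ LinearMap.ker (chainProj I i n - LinearMap.id) := by
    refine chainSpan_le (fun c w _ _ hi h hn => ?_) hx
    have hn : (w ⋆ c).length = n := hn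
    rw [length_cat h] at hn
    rw [LinearMap.mem_ker, LinearMap.sub_apply, LinearMap.id_apply, chainProj, if_pos (by omega),
      Finsupp.mapRange.linearMap_apply, Finsupp.mapRange_single,
      proj_pathClass_of_eq I (by omega), sub_self]
  exact sub_eq_zero.1 this

theorem chainProj_of_mem_of_ne {i m n : ℕ} (hmn : m ≠ n) {x : FreePathModule I}
    (hx : x ∈ chainSpan I B i {p | p.length = m}) : chainProj I i n x = 0 := by
  have : x ∈ LinearMap.ker (chainProj I i n) := by
    refine chainSpan_le (fun c w _ _ hi h hm => ?_) hx
    have hm : (w ⋆ c).length = m := hm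
    rw [length_cat h] at hm
    rw [LinearMap.mem_ker, chainProj]
    split_ifs with hin
    · rw [Finsupp.mapRange.linearMap_apply, Finsupp.mapRange_single,
        proj_pathClass_of_ne I (by omega), Finsupp.single_zero]
    · rfl
  exact this

theorem chainGrading_isInternal : DirectSum.IsInternal (chainGrading hB hI i) := by
  refine ⟨injective_coeAddMonoidHom_of_projections _ (chainModule hB hI i).subtype.toAddMonoidHom
    Subtype.val_injective (fun n => (chainProj I i n).toAddMonoidHom)
    (fun n x hx => chainProj_of_mem hx) (fun m n hmn x hx => chainProj_of_mem_of_ne hmn hx), ?_⟩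
  rintro ⟨x, hx⟩
  suffices h : ∃ y, ((DirectSum.coeAddMonoidHom (chainGrading hB hI i) y :
      chainModule hB hI i) : FreePathModule I) = x by
    obtain ⟨y, hy⟩ := h
    exact ⟨y, Subtype.ext hy⟩
  change x ∈ chainSpan I B i Set.univ at hx
  induction hx using Submodule.closure_induction with
  | zero => exact ⟨0, by simp⟩
  | add x y _ _ hx hy =>
    obtain ⟨x, rfl⟩ := hx
    obtain ⟨y, rfl⟩ := hy
    exact ⟨x + y, by rw [map_add]; rfl⟩
  | smul_mem a x hx =>
    obtain ⟨⟨c, w⟩, ⟨h1, h2, h3, h4, -⟩, rfl⟩ := hx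
    have hmem : ∀ S, w ⋆ c ∈ S →
        a • (Finsupp.single c (pathClass I.toIdeal w) : FreePathModule I) ∈
          chainSpan I B i S := fun S hS =>
      Submodule.smul_mem _ a (single_mem_chainSpan h1 h2 h3 h4 hS)
    exact ⟨DirectSum.of (fun n => chainGrading hB hI i n) (w ⋆ c).length
      ⟨⟨_, hmem Set.univ trivial⟩, hmem {p | p.length = (w ⋆ c).length} rfl⟩, by
        rw [DirectSum.coeAddMonoidHom_of]⟩

/-- The generator `e_v[c]` of `chainModule`, for a chain `c` of length `i` starting at `v`. -/
def chainGenerator (c : {c : QuiverPath V // IsChain B c ∧ c.length = i}) :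
    chainModule hB hI i :=
  ⟨Finsupp.single c.1 (pathClass I.toIdeal (vertex c.1.source)),
    single_mem_chainSpan (hI _ (by simp)) c.2.1 c.2.2 rfl trivial⟩

theorem chainGenerator_mem (c : {c : QuiverPath V // IsChain B c ∧ c.length = i}) :
    chainGenerator hB hI i c ∈ chainGrading hB hI i i :=
  single_mem_chainSpan (hI _ (by simp)) c.2.1 c.2.2 rfl (by
    rw [vertex_cat]
    exact c.2.2)

theorem pathClass_smul_chainGenerator (c : {c : QuiverPath V // IsChain B c ∧ c.length = i})
    {w : QuiverPath V} (h : w.target = c.1.source) :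
    ((pathClass I.toIdeal w • chainGenerator hB hI i c : chainModule hB hI i) :
      FreePathModule I) = Finsupp.single c.1 (pathClass I.toIdeal w) := by
  rw [Submodule.coe_smul, chainGenerator, Finsupp.smul_single, smul_eq_mul, ← h,
    pathClass_mul_vertex]

theorem span_chainGenerator :
    Submodule.span (QuotientAlgebra I.toIdeal) (Set.range (chainGenerator hB hI i)) = ⊤ := by
  rw [eq_top_iff]
  rintro ⟨x, hx⟩ -
  have h : chainSpan I B i Set.univ ≤ ((Submodule.span (QuotientAlgebra I.toIdeal)
      (Set.range (chainGenerator hB hI i))).map (chainModule hB hI i).subtype).restrictScalars F :=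
    chainSpan_le fun c w _ hc hi h _ =>
      ⟨pathClass I.toIdeal w • chainGenerator hB hI i ⟨c, hc, hi⟩,
        Submodule.smul_mem _ _ (Submodule.subset_span ⟨_, rfl⟩),
        pathClass_smul_chainGenerator hB hI i ⟨c, hc, hi⟩ h⟩
  obtain ⟨y, hy, hyx⟩ := h hx
  convert! hy
  exact hyx.symm

theorem chainModule_finite [Finite (Quiver.Total V)] :
    Module.Finite (QuotientAlgebra I.toIdeal) (chainModule hB hI i) := by
  have : Finite {c : QuiverPath V // IsChain B c ∧ c.length = i} :=
    ((finite_length_eq (V := V) i).subset fun c hc => hc.2).to_subtype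
  refine ⟨?_⟩
  rw [← span_chainGenerator hB hI i]
  exact Submodule.fg_span (Set.finite_range _)

/-- The map `[c] ↦ e_v[c]` on chains of length `i`, and zero on other paths, retracts the free
module on all paths onto this submodule. -/
theorem chainModule_projective :
    Module.Projective (QuotientAlgebra I.toIdeal) (chainModule hB hI i) := by
  classical
  let s : FreePathModule I →ₗ[QuotientAlgebra I.toIdeal] chainModule hB hI i :=
    Finsupp.linearCombination _ fun c =>
      if h : IsChain B c ∧ c.length = i then chainGenerator hB hI i ⟨c, h⟩ else 0
  refine Module.Projective.of_split (chainModule hB hI i).subtype s (LinearMap.ext ?_)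
  rintro ⟨x, hx⟩
  refine Subtype.ext ?_
  have h : chainSpan I B i Set.univ ≤ LinearMap.ker
      (((chainModule hB hI i).subtype ∘ₗ s).restrictScalars F - LinearMap.id) := by
    refine chainSpan_le fun c w _ hc hi h _ => ?_
    rw [LinearMap.mem_ker, LinearMap.sub_apply, LinearMap.id_apply, sub_eq_zero,
      LinearMap.restrictScalars_apply, LinearMap.comp_apply]
    simp only [s, Finsupp.linearCombination_single]
    rw [dif_pos ⟨hc, hi⟩]
    exact pathClass_smul_chainGenerator hB hI i ⟨c, hc, hi⟩ h
  exact sub_eq_zero.1 (h hx)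

end Terms

/-- The linear resolution of a path algebra with relations that has a PBW basis. -/
theorem IsPBWBasis.nonempty_linearResolution (hB : IsPBWBasis I.toIdeal o B)
    (hI : ∀ p : QuiverPath V, p.length ≤ 1 → p ∈ B) [Finite (Quiver.Total V)] :
    Nonempty (LinearResolution (quotientGrading (PathAlgebra.grading F V) I)) := by
  obtain ⟨d, hd0, hd⟩ := exists_differentials hB hI
  have hlead : ∀ i, HasLeadingTerm o B i (d i) := fun i => by
    cases i with
    | zero => exact hd0.leading
    | succ i => exact (hd i).leading
  refine ⟨{
    P := fun i => chainModule hB hI i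
    gr := fun i => chainGrading hB hI i
    isInternal := chainGrading_isInternal hB hI
    smul_mem := fun i m n a x ha hx => ?_
    finite := fun i => chainModule_finite hB hI i
    projective := chainModule_projective hB hI
    generated := fun i => ?_
    d := fun i => (d i).restrict fun x hx =>
      (hlead i).map_mem_chainSpan hB hI (isHomLower_univ o) hx
    d_mem := fun i n x hx => (hlead i).map_mem_chainSpan hB hI (isHomLower_length o n) hx
    ε := (augmentation I).comp (chainModule hB hI 0).subtype
    ε_degree := fun n x hn hx => ?_
    ε_surjective := fun s => ?_
    exact_zero := fun x => ?_
    exact_succ := fun i x => ?_ }⟩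
  · rw [quotientGrading_eq_span] at ha
    refine hB.smul_mem_chainSpan_of_mem_span hI (isHomLower_length o _) ?_ ha hx
    intro u hu r hr h
    change (u ⋆ r).length = m + n
    rw [length_cat h, show u.length = m from hu, show r.length = n from hr]
  · rw [eq_top_iff, ← span_chainGenerator hB hI i]
    refine Submodule.span_mono ?_
    rintro _ ⟨c, rfl⟩
    exact chainGenerator_mem hB hI i c
  · have h : chainSpan I B 0 {p | p.length = n} ≤ LinearMap.ker
        (GradedAlgebra.proj (quotientGrading (PathAlgebra.grading F V) I) 0 ∘ₗ
          (coeffSum I).restrictScalars F) := by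
      refine chainSpan_le fun c w _ _ hi h hwc => ?_
      have hwc : (w ⋆ c).length = n := hwc
      rw [length_cat h] at hwc
      rw [LinearMap.mem_ker, LinearMap.comp_apply, LinearMap.restrictScalars_apply,
        coeffSum_single, proj_pathClass_of_ne I (by omega)]
    exact Subtype.ext (h hx)
  -- The element `∑ v, s e_v [v]` has coefficient sum `s`, so it is a preimage under the
  -- augmentation.
  · have h : spread I (s : QuotientAlgebra I.toIdeal) ∈ chainSpan I B 0 Set.univ := by
      have h1 : (s : QuotientAlgebra I.toIdeal) ∈ Submodule.span F (pathClass I.toIdeal '' B) :=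
        hB.span_eq_top ▸ Submodule.mem_top
      refine (Submodule.span_le (p := (chainSpan I B 0 Set.univ).comap (spread I))).2 ?_ h1
      rintro _ ⟨w, hw, rfl⟩
      rw [SetLike.mem_coe, Submodule.mem_comap, spread_pathClass]
      exact _root_.single_mem_chainSpan hw (QuiverPath.IsChain.of_length_le_one (by simp)) rfl rfl trivial
    refine ⟨⟨_, h⟩, ?_⟩
    change GradedRing.projZeroRingHom' _ (coeffSum I (spread I s)) = s
    rw [coeffSum_spread, GradedRing.projZeroRingHom'_apply_coe]
  · constructor
    · intro hx
      obtain ⟨y, hy, hyx⟩ := hd0.exact _ (isHomLower_univ o) x.1 hx x.2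
      exact ⟨⟨y, hy⟩, Subtype.ext hyx⟩
    · rintro ⟨y, rfl⟩
      exact hd0.map_mem y.1
  · constructor
    · intro hx
      obtain ⟨y, hy, hyx⟩ := (hd i).exact _ (isHomLower_univ o) x.1
        (congrArg Subtype.val hx) x.2
      exact ⟨⟨y, hy⟩, Subtype.ext hyx⟩
    · rintro ⟨y, rfl⟩
      exact Subtype.ext ((hd i).map_mem y.1)

end Resolution

/-! ### Semisimplicity in degree zero and generation in degree one -/

section Koszul

variable {F V : Type*} [Field F] [Quiver V] [Fintype V]
  (I : HomogeneousIdeal (PathAlgebra.grading F V)) [I.toIdeal.IsTwoSided]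

/-- The trivial paths give orthogonal idempotents that sum to one and span degree zero, so this ring
is a quotient of a finite product of copies of the field. -/
theorem isSemisimpleRing_quotientGrading_zero :
    IsSemisimpleRing (quotientGrading (PathAlgebra.grading F V) I 0) := by
  classical
  let L : (V → F) →ₗ[F] QuotientAlgebra I.toIdeal :=
    Fintype.linearCombination F fun v => pathClass I.toIdeal (vertex v)
  have hL : ∀ f, L f = ∑ v, f v • pathClass I.toIdeal (vertex v) := fun f => rfl
  have hmem : ∀ f, L f ∈ quotientGrading (PathAlgebra.grading F V) I 0 := fun f =>
    Submodule.sum_mem _ fun v _ => Submodule.smul_mem _ _ (pathClass_mem_grading I (vertex v))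
  let φ : (V → F) →+* quotientGrading (PathAlgebra.grading F V) I 0 :=
    { toFun := fun f => ⟨L f, hmem f⟩
      map_zero' := Subtype.ext (map_zero L)
      map_add' := fun f g => Subtype.ext (map_add L f g)
      map_one' := Subtype.ext (by
        change L 1 = 1
        rw [hL, one_eq_sum_pathClass]
        simp)
      map_mul' := fun f g => Subtype.ext (by
        change L (f * g) = L f * L g
        simp only [hL, Finset.sum_mul_sum]
        refine Finset.sum_congr rfl fun v _ => ?_
        rw [Finset.sum_eq_single v]
        · rw [smul_mul_smul_comm, pathClass_mul _ rfl, cat_vertex]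
          rfl
        · intro u _ hu
          rw [smul_mul_smul_comm, pathClass_mul_of_ne _ (by simpa using hu.symm), smul_zero]
        · simp) }
  refine RingHom.isSemisimpleRing_of_surjective φ ?_
  rintro ⟨x, hx⟩
  have h : quotientGrading (PathAlgebra.grading F V) I 0 ≤ LinearMap.range L := by
    rw [quotientGrading_eq_span, Submodule.span_le]
    rintro _ ⟨p, hp, rfl⟩
    refine ⟨Pi.single p.source 1, ?_⟩
    rw [hL, Finset.sum_eq_single p.source]
    · rw [Pi.single_eq_same, one_smul, ← eq_vertex_of_length_eq_zero hp]
    · intro v _ hv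
      rw [Pi.single_eq_of_ne hv, zero_smul]
    · simp
  obtain ⟨f, hf⟩ := h hx
  exact ⟨f, Subtype.ext hf⟩

theorem quotientGrading_one_pow {n : ℕ} (hn : 1 ≤ n) :
    quotientGrading (PathAlgebra.grading F V) I 1 ^ n =
      quotientGrading (PathAlgebra.grading F V) I n := by
  induction n, hn using Nat.le_induction with
  | base => rw [pow_one]
  | succ n hn ih =>
    rw [pow_succ, ih]
    refine le_antisymm (Submodule.mul_le.2 fun x hx y hy => SetLike.mul_mem_graded hx hy) ?_
    rw [quotientGrading_eq_span I (n + 1), Submodule.span_le]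
    rintro _ ⟨p, hp, rfl⟩
    have hp : p.length = n + 1 := hp
    obtain ⟨q, a, h, ha, rfl⟩ := exists_cat_of_le' (p := p) (k := 1) (by omega)
    rw [length_cat h] at hp
    rw [SetLike.mem_coe, ← pathClass_mul _ h]
    have hq : q.length = n := by omega
    exact Submodule.mul_mem_mul (hq ▸ pathClass_mem_grading I q) (ha ▸ pathClass_mem_grading I a)

end Koszul

theorem theorem2p13 {F V : Type*} [Field F] [IsAlgClosed F] [Quiver V] [Fintype V]
    [Finite (Quiver.Total V)]
    (I : HomogeneousIdeal (PathAlgebra.grading F V)) [I.toIdeal.IsTwoSided]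
    (hI : ∀ x ∈ I.toIdeal,
      x ∈ Submodule.span F
        ((PathAlgebra.ofPath : QuiverPath V → PathAlgebra F V) '' {p | 2 ≤ p.length}))
    (hB : ∃ (o : LinearOrder (Quiver.Total V)) (B : Set (QuiverPath V)),
      IsPBWBasis I.toIdeal o B) :
    IsKoszul (quotientGrading (PathAlgebra.grading F V) I) := by
  obtain ⟨o, B, hB⟩ := hB
  exact ⟨isSemisimpleRing_quotientGrading_zero I,
    fun n hn => quotientGrading_one_pow I (by omega),
    hB.nonempty_linearResolution fun p hp => hB.mem_of_length_le_one hI hp⟩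

end
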